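/- Let $S$ be a finite semigroup, and let $2^S$ be the semigroup of subsets of $S$ with the product $T\cdot T'=\{s s' \mid s\in T,\ s'\in T'\}$. For $\mathcal X\subseteq 2^S$ write $\bigcup\mathcal X=\bigcup_{T\in\mathcal X}T\subseteq S$. For $T\in 2^S$ let $T^\omega$ denote the unique idempotent among the powers $T^n$ ($n\ge 1$), and let $T^{\omega+1}=T^\omega\cdot T$. For a subsemigroup $\mathcal S$ of $2^S$, let $\mathrm{Sat}(\mathcal S)$ be the smallest subset of $2^S$ that contains $\mathcal S$ and is closed under (1) downset: if $T'\in\mathrm{Sat}(\mathcal S)$ and $T\subseteq T'$, then $T\in\mathrm{Sat}(\mathcal S)$; (2) multiplication: if $T,T'\in\mathrm{Sat}(\mathcal S)$, then $T T'\in\mathrm{Sat}(\mathcal S)$; (3) FO-closure: if $T\in\mathrm{Sat}(\mathcal S)$, then $T^\omega\cup T^{\omega+1}\in\mathrm{Sat}(\mathcal S)$. For a finite alphabet $B$, let $B^+$ be the semigroup of nonempty finite words over $B$. A word is viewed as a structure whose elements are its positions, and first-order formulas use the order $<$ on positions and, for each letter $b\in B$, a unary predicate $b(x)$ that selects the positions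 labelled $b$. A sentence $\varphi$ defines the language $\{w\in B^+ \mid w\models\varphi\}$, and its rank is its quantifier rank, the largest number of nested quantifiers. An FO-partition of $B^+$ is a finite partition of $B^+$ all of whose blocks are definable by first-order sentences. **Proposition.** Let $S$ be a finite semigroup, $\mathcal S$ a subsemigroup of $2^S$, $B$ a finite alphabet and $\beta:B^+\to\mathcal S$ a surjective semigroup morphism. Then there exists an FO-partition $\mathbf K$ of $B^+$ such that for all $K\in\mathbf K$: 1. $\bigcup\beta(K)\in\mathrm{Sat}(\mathcal S)$, where $\beta(K)=\{\beta(w)\mid w\in K\}$; 2. $K$ can be defined by a first-order sentence of rank at most $|B|\cdot 2^{|\bigcup\mathcal S|^2}$. -/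

import Mathlib

open scoped Pointwise

namespace FOSeparation

universe u v

/-! ### Finite words and first-order logic over words

The set `B⁺` of nonempty finite words over the alphabet `B` is `FreeSemigroup B`. -/

section Words

variable {B : Type u}

/-- The list of letters of a nonempty word. -/
def letters (w : FreeSemigroup B) : List B := w.head :: w.tail

/-- The positions of a word. -/
def Pos (w : FreeSemigroup B) : Type := Fin (letters w).length

/-- The predicate symbols of `FO(<)`: a unary symbol for each letter and a binary symbol `<`. -/
inductive WordRel (B : Type u) : ℕ → Type u
  | letter (b : B) : WordRel B 1
  | lt : WordRel B 2

/-- The signature of `FO(<)` on words over `B` (there are no function symbols). -/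
def wordLang (B : Type u) : FirstOrder.Language.{0, u} := ⟨fun _ => Empty, WordRel B⟩

/-- A word viewed as a structure: the domain is its set of positions, `letter b` selects the
positions labelled `b`, and `lt` is the order of positions. -/
instance wordStructure (w : FreeSemigroup B) : (wordLang B).Structure (Pos w) where
  funMap := fun f _ => f.elim
  RelMap := fun {_} r =>
    match r with
    | WordRel.letter b => fun x => (letters w).get (x 0) = b
    | WordRel.lt => fun x => Fin.val (x 0) < Fin.val (x 1)

/-- The quantifier rank of a first-order formula. -/
def qrank {L : FirstOrder.Language} {α : Type*} :
    {n : ℕ} → L.BoundedFormula α n → ℕ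
  | _, .falsum => 0
  | _, .equal _ _ => 0
  | _, .rel _ _ => 0
  | _, .imp φ ψ => max (qrank φ) (qrank ψ)
  | _, .all φ => qrank φ + 1

/-- The language `{w ∈ B⁺ | w ⊨ φ}` defined by a sentence `φ`. -/
def definedBy (φ : (wordLang B).Sentence) : Set (FreeSemigroup B) :=
  {w | FirstOrder.Language.Sentence.Realize (Pos w) φ}

/-- First-order definable languages. -/
def IsFO (K : Set (FreeSemigroup B)) : Prop :=
  ∃ φ : (wordLang B).Sentence, definedBy φ = K

/-- An FO-partition of `B⁺`: a finite partition of `B⁺` (into nonempty blocks) all of whose blocks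
are first-order definable. -/
structure IsFOPartition (P : Set (Set (FreeSemigroup B))) : Prop where
  finite : P.Finite
  isPartition : Setoid.IsPartition P
  isFO : ∀ K ∈ P, IsFO K

end Words

/-! ### Powers in a semigroup -/

section Powers

variable {X : Type u} [Semigroup X]

/-- The power `s ^ n` (`n ≥ 1`) in a semigroup. -/
def spow (s : X) (n : ℕ+) : X := PNat.recOn n s fun _ t => t * s

theorem spow_one (s : X) : spow s 1 = s := rfl

theorem spow_succ (s : X) (n : ℕ+) : spow s (n + 1) = spow s n * s := by
  simp [spow, PNat.recOn_succ]

theorem spow_add (s : X) (m n : ℕ+) : spow s (m + n) = spow s m * spow s n := by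
  induction n using PNat.recOn with
  | one => rw [spow_succ, spow_one]
  | succ n ih => rw [← add_assoc, spow_succ, ih, spow_succ, mul_assoc]

/-- In a finite semigroup every element has an idempotent power `s ^ ω`. -/
theorem exists_idempotent_spow [Finite X] (s : X) : ∃ n : ℕ+, IsIdempotentElem (spow s n) := by
  obtain ⟨i, p, h⟩ : ∃ i p : ℕ+, spow s (i + p) = spow s i := by
    obtain ⟨a, b, hab, h⟩ := Finite.exists_ne_map_eq_of_infinite (spow s)
    rcases lt_or_gt_of_ne hab with hlt | hlt
    · exact ⟨a, b - a, by rw [PNat.add_sub_of_lt hlt, h]⟩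
    · exact ⟨b, a - b, by rw [PNat.add_sub_of_lt hlt, h]⟩
  have h1 : ∀ k : ℕ+, spow s (i + k * p) = spow s i := by
    intro k
    induction k using PNat.recOn with
    | one => rw [one_mul, h]
    | succ k ih =>
      rw [add_mul, one_mul, ← add_assoc, add_right_comm, spow_add, h, ← spow_add, ih]
  have h2 : ∀ k : ℕ+, spow s (i * p + k * p) = spow s (i * p) := by
    intro k
    by_cases hp : p = 1
    · subst hp; simpa using h1 k
    · obtain ⟨q, hq⟩ : ∃ q, i * p = i + q :=
        ⟨i * p - i, (PNat.add_sub_of_lt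
          (lt_mul_of_one_lt_right' i (lt_of_le_of_ne (one_le (a := p)) (Ne.symm hp)))).symm⟩
      rw [hq, add_right_comm, spow_add, h1, ← spow_add]
  exact ⟨i * p, by rw [IsIdempotentElem, ← spow_add, h2]⟩

/-- The idempotent power `s ^ ω` does not depend on the exponent. -/
theorem idempotent_spow_unique (s : X) {m n : ℕ+} (hm : IsIdempotentElem (spow s m))
    (hn : IsIdempotentElem (spow s n)) : spow s m = spow s n := by
  have key : ∀ {a : ℕ+}, IsIdempotentElem (spow s a) → ∀ k : ℕ+, spow s (a * k) = spow s a := by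
    intro a ha k
    induction k using PNat.recOn with
    | one => rw [mul_one]
    | succ k ih => rw [mul_add, mul_one, spow_add, ih, ha]
  rw [← key hm n, ← key hn m, mul_comm]

end Powers

/-! ### Saturation -/

section Saturation

variable {S : Type v} [Semigroup S]

/-- Membership in the least subset of `2^S` that contains `𝒮` and is closed under downset,
multiplication and FO-closure. In the last rule `n` is any exponent for which `T ^ n` is
idempotent, that is, `T ^ n = T ^ ω`, so that `T ^ (n + 1) = T ^ (ω + 1)`. -/
inductive MemSat (𝒮 : Subsemigroup (Set S)) : Set S → Prop
  | base {T : Set S} (hT : T ∈ 𝒮) : MemSat 𝒮 T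
  | downset {T T' : Set S} (hT' : MemSat 𝒮 T') (h : T ⊆ T') : MemSat 𝒮 T
  | mul {T T' : Set S} (hT : MemSat 𝒮 T) (hT' : MemSat 𝒮 T') : MemSat 𝒮 (T * T')
  | foClosure {T : Set S} (hT : MemSat 𝒮 T) (n : ℕ+) (hn : IsIdempotentElem (spow T n)) :
      MemSat 𝒮 (spow T n ∪ spow T (n + 1))

/-- The saturation `Sat(𝒮)`. -/
def Sat (𝒮 : Subsemigroup (Set S)) : Set (Set S) := {T | MemSat 𝒮 T}

end Saturation

end FOSeparation

/-! The blocks of the partition are the classes of equal rank `k` type, which rank `k` sentences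
define (`exists_sentence_tp_eq`). What remains is algebraic: for an alphabet `A` of subsets of `S`
and `R` the union of the semigroup generated by `A`, words over `A` of equal type of rank `m * 2 ^ n
^ 2`, with `|A| ≤ m` and `|R| ≤ n`, have values below one member of the saturation (`bnd_tp`). The
induction is on `n`, then on `m`.

If `a R = R = R a` for all letters `a`, then `R` itself is saturated (`MemSat.sUnion_of_tame`).
Indeed, the saturated sets `T` with `T R = R = R T` form a finite semigroup closed under FO-closure.
Choose an idempotent `e` in it with minimal local monoid; that monoid is a group, and FO-closure
forces each of its elements to lie inside `e` (`exists_absorbing`). Hence `R = e R e ⊆ e`.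

Otherwise some letter `b` has `b R ⊊ R` or `R b ⊊ R`. Words are cut into blocks, each a run of `b`
followed by a nonempty word without `b` in the first case, and the reverse order in the second. All
block values lie in the smaller set `Q = b R` or `Q = R b`. Inside a block, the words without `b`
are handled by induction on `m` and the runs by `MemSat.exists_bound_spow`. Replacing each block by
the union of the values of its type class gives a word over at most `2 ^ |Q|` saturated letters, all
contained in `Q`, so induction on `n` applies (`Bnd.of_blocks`). The transfer works because types of
a word control types of its block word, one round on blocks costing one round on letters
(`Dec.tp_map`). -/

open scoped Pointwise

namespace FOSeparation

universe u v

/-! ### Ehrenfeucht-Fraïssé types of words -/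

section Types

/-- The rank `k` types of words over the alphabet `α`. -/
def Ty (α : Type u) : ℕ → Type u
  | 0 => PUnit
  | k + 1 => Set (Ty α k × α × Ty α k)

instance Ty.instFinite (α : Type u) [Finite α] : ∀ k, Finite (Ty α k)
  | 0 => inferInstanceAs (Finite PUnit)
  | k + 1 =>
    haveI := Ty.instFinite α k
    inferInstanceAs (Finite (Set (Ty α k × α × Ty α k)))

/-- The rank `k` type of a word: two words have the same type if and only if Spoiler and Duplicator
play to a draw in the Ehrenfeucht-Fraïssé game with `k` rounds. -/
def tp {α : Type u} : (k : ℕ) → List α → Ty α k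
  | 0, _ => PUnit.unit
  | k + 1, w => {t : Ty α k × α × Ty α k | ∃ u a v, w = u ++ a :: v ∧ t = (tp k u, a, tp k v)}

variable {α : Type u}

theorem mem_tp_succ {k : ℕ} {w : List α} {t : Ty α k × α × Ty α k} :
    (show Set (Ty α k × α × Ty α k) from tp (k + 1) w) t ↔
      ∃ u a v, w = u ++ a :: v ∧ t = (tp k u, a, tp k v) := Iff.rfl

theorem tp_succ_split {k : ℕ} {u v w' : List α} {a : α}
    (h : tp (k + 1) (u ++ a :: v) = tp (k + 1) w') :
    ∃ u' v', w' = u' ++ a :: v' ∧ tp k u = tp k u' ∧ tp k v = tp k v' := by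
  have h1 : (show Set (Ty α k × α × Ty α k) from tp (k + 1) w') (tp k u, a, tp k v) := by
    rw [← h]; exact ⟨u, a, v, rfl, rfl⟩
  obtain ⟨u', a', v', hw, ht⟩ := h1
  simp only [Prod.mk.injEq] at ht
  obtain ⟨h1, rfl, h2⟩ := ht
  exact ⟨u', v', hw, h1, h2⟩

theorem tp_succ_eq {k : ℕ} {w w' : List α}
    (h1 : ∀ u a v, w = u ++ a :: v →
      ∃ u' v', w' = u' ++ a :: v' ∧ tp k u = tp k u' ∧ tp k v = tp k v')
    (h2 : ∀ u a v, w' = u ++ a :: v →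
      ∃ u' v', w = u' ++ a :: v' ∧ tp k u = tp k u' ∧ tp k v = tp k v') :
    tp (k + 1) w = tp (k + 1) w' := by
  refine Set.ext fun t => ⟨?_, ?_⟩
  · rintro ⟨u, a, v, hw, rfl⟩
    obtain ⟨u', v', hw', e1, e2⟩ := h1 u a v hw
    exact ⟨u', a, v', hw', by rw [e1, e2]⟩
  · rintro ⟨u, a, v, hw, rfl⟩
    obtain ⟨u', v', hw', e1, e2⟩ := h2 u a v hw
    exact ⟨u', a, v', hw', by rw [e1, e2]⟩

theorem tp_of_succ {k : ℕ} {w w' : List α} (h : tp (k + 1) w = tp (k + 1) w') :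
    tp k w = tp k w' := by
  induction k generalizing w w' with
  | zero => rfl
  | succ k ih =>
    have key : ∀ {w w' : List α}, tp (k + 1 + 1) w = tp (k + 1 + 1) w' → ∀ u a v,
        w = u ++ a :: v → ∃ u' v', w' = u' ++ a :: v' ∧ tp k u = tp k u' ∧ tp k v = tp k v' := by
      rintro w w' h u a v rfl
      obtain ⟨u', v', hw, e1, e2⟩ := tp_succ_split h
      exact ⟨u', v', hw, ih e1, ih e2⟩
    exact tp_succ_eq (key h) (key h.symm)

theorem tp_mono {j k : ℕ} (hjk : j ≤ k) {w w' : List α} (h : tp k w = tp k w') :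
    tp j w = tp j w' := by
  induction hjk with
  | refl => exact h
  | step _ ih => exact ih (tp_of_succ h)

/-- Duplicator answers in the factor where Spoiler played; the untouched factor keeps its type at
the lower rank. -/
theorem tp_append {k : ℕ} {u u' v v' : List α} (hu : tp k u = tp k u') (hv : tp k v = tp k v') :
    tp k (u ++ v) = tp k (u' ++ v') := by
  induction k generalizing u u' v v' with
  | zero => rfl
  | succ k ih =>
    have key : ∀ {u u' v v' : List α}, tp (k + 1) u = tp (k + 1) u' → tp (k + 1) v = tp (k + 1) v' →
        ∀ x a y, u ++ v = x ++ a :: y →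
          ∃ x' y', u' ++ v' = x' ++ a :: y' ∧ tp k x = tp k x' ∧ tp k y = tp k y' := by
      intro u u' v v' hu hv x a y h
      rcases List.append_eq_append_iff.1 h with ⟨z, rfl, rfl⟩ | ⟨z, rfl, h2⟩
      · obtain ⟨x', y', rfl, e1, e2⟩ := tp_succ_split hv
        exact ⟨u' ++ x', y', by simp, ih (tp_of_succ hu) e1, e2⟩
      · rcases List.cons_eq_append_iff.1 h2 with ⟨rfl, h3⟩ | ⟨z', rfl, rfl⟩
        · subst h3
          rw [List.append_nil] at hu
          obtain ⟨x', y', rfl, e1, e2⟩ := tp_succ_split (u := []) hv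
          refine ⟨u' ++ x', y', by simp, ?_, e2⟩
          simpa using ih (tp_of_succ hu) e1
        · obtain ⟨x', y', rfl, e1, e2⟩ := tp_succ_split hu
          exact ⟨x', y' ++ v', by simp, e1, ih e2 (tp_of_succ hv)⟩
    exact tp_succ_eq (key hu hv) (key hu.symm hv.symm)

theorem tp_map {β : Type v} (f : α → β) {k : ℕ} {w w' : List α} (h : tp k w = tp k w') :
    tp k (w.map f) = tp k (w'.map f) := by
  induction k generalizing w w' with
  | zero => rfl
  | succ k ih =>
    have key : ∀ {w w' : List α}, tp (k + 1) w = tp (k + 1) w' → ∀ u a v,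
        w.map f = u ++ a :: v →
          ∃ u' v', w'.map f = u' ++ a :: v' ∧ tp k u = tp k u' ∧ tp k v = tp k v' := by
      intro w w' h u a v hw
      obtain ⟨u, z, rfl, rfl, hz⟩ := List.map_eq_append_iff.1 hw
      obtain ⟨a, v, rfl, rfl, rfl⟩ := List.map_eq_cons_iff.1 hz
      obtain ⟨u', v', rfl, e1, e2⟩ := tp_succ_split h
      exact ⟨u'.map f, v'.map f, by simp, ih e1, ih e2⟩
    exact tp_succ_eq (key h) (key h.symm)

theorem forall_mem_of_tp {p : α → Prop} {k : ℕ} {w w' : List α}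
    (h : tp (k + 1) w = tp (k + 1) w') (hw : ∀ a ∈ w, p a) : ∀ a ∈ w', p a := by
  intro a ha
  obtain ⟨u, v, rfl⟩ := List.append_of_mem ha
  obtain ⟨u', v', rfl, -, -⟩ := tp_succ_split h.symm
  exact hw a (by simp)

theorem eq_nil_of_tp {k : ℕ} {w' : List α} (h : tp (k + 1) [] = tp (k + 1) w') : w' = [] :=
  List.eq_nil_iff_forall_not_mem.2 (forall_mem_of_tp (p := fun _ => False) h (by simp))

/-- Each round strips the first letter. This linear threshold is far from optimal, but it suffices
for runs of a single letter. -/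
theorem length_of_tp {k : ℕ} {w w' : List α} (h : tp k w = tp k w') :
    w.length = w'.length ∨ k ≤ w.length ∧ k ≤ w'.length := by
  induction k generalizing w w' with
  | zero => right; simp
  | succ k ih =>
    rcases w with _ | ⟨a, w⟩
    · left; rw [eq_nil_of_tp h]
    · obtain ⟨u', v', rfl, e1, e2⟩ := tp_succ_split (u := []) h
      rcases k with _ | k
      · right; simp only [List.length_append, List.length_cons]; omega
      · obtain rfl := eq_nil_of_tp e1
        rcases ih e2 with h | h <;> simp <;> omega

end Types

/-! ### Factors of a word between two positions -/

section Segments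

variable {α : Type u}

/-- The factor of a word that consists of the positions `i` with `l ≤ i < h`. -/
def seg (w : List α) (l h : ℕ) : List α := (w.take h).drop l

theorem seg_eq_append_cons {w : List α} {l h i : ℕ} (hi : i < w.length) (hl : l ≤ i) (hh : i < h) :
    seg w l h = seg w l i ++ w[i] :: seg w (i + 1) h := by
  have h1 : (w.take h).take i = w.take i := by rw [List.take_take, min_eq_left hh.le]
  have h2 : i < (w.take h).length := by rw [List.length_take]; omega
  have h3 : (w.take h)[i] = w[i] := by rw [List.getElem_take]
  have h4 := List.take_append_drop i (w.take h)
  rw [List.drop_eq_getElem_cons h2, h1, h3] at h4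
  unfold seg
  conv_lhs => rw [← h4]
  rw [List.drop_append_of_le_length (by rw [List.length_take]; omega)]

theorem seg_eq_append_cons_iff {w u v : List α} {a : α} {l h : ℕ} :
    seg w l h = u ++ a :: v ↔ ∃ (i : ℕ) (hi : i < w.length), l ≤ i ∧ i < h ∧
      seg w l i = u ∧ w[i] = a ∧ seg w (i + 1) h = v := by
  constructor
  · intro e
    have h0 := congrArg List.length e
    simp only [seg, List.length_drop, List.length_take, List.length_append, List.length_cons] at h0
    have hi : l + u.length < w.length := by omega
    have e' := seg_eq_append_cons (w := w) (l := l) (h := h) hi (by omega) (by omega)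
    rw [e] at e'
    obtain ⟨e1, e2⟩ := List.append_inj e' (by
      simp only [seg, List.length_drop, List.length_take]
      omega)
    obtain ⟨e2, e3⟩ := List.cons.inj e2
    exact ⟨l + u.length, hi, by omega, by omega, e1.symm, e2.symm, e3.symm⟩
  · rintro ⟨i, hi, hl, hh, rfl, rfl, rfl⟩
    exact seg_eq_append_cons hi hl hh

theorem mem_tp_seg {k : ℕ} {w : List α} {l h : ℕ} {t : Ty α k × α × Ty α k} :
    (show Set (Ty α k × α × Ty α k) from tp (k + 1) (seg w l h)) t ↔
      ∃ (i : ℕ) (hi : i < w.length), l ≤ i ∧ i < h ∧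
        tp k (seg w l i) = t.1 ∧ w[i] = t.2.1 ∧ tp k (seg w (i + 1) h) = t.2.2 := by
  rw [mem_tp_succ]
  constructor
  · rintro ⟨u, a, v, e, rfl⟩
    obtain ⟨i, hi, hl, hh, rfl, rfl, rfl⟩ := seg_eq_append_cons_iff.1 e
    exact ⟨i, hi, hl, hh, rfl, rfl, rfl⟩
  · rintro ⟨i, hi, hl, hh, e1, e2, e3⟩
    obtain ⟨x, a, y⟩ := t
    subst e1 e2 e3
    exact ⟨_, _, _, seg_eq_append_cons hi hl hh, rfl⟩

end Segments

/-! ### Types are first-order definable -/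

section Definability

open FirstOrder FirstOrder.Language

variable {B : Type u}

/-- A relation of arity `n` on the positions of words that is defined by a formula of quantifier
rank at most `k`. -/
def FODef (k n : ℕ) (p : (w : FreeSemigroup B) → (Fin n → Pos w) → Prop) : Prop :=
  ∃ φ : (wordLang B).BoundedFormula Empty n, qrank φ ≤ k ∧
    ∀ (w : FreeSemigroup B) (x : Fin n → Pos w), φ.Realize default x ↔ p w x

namespace FODef

variable {k n : ℕ} {p q : (w : FreeSemigroup B) → (Fin n → Pos w) → Prop}

theorem congr (h : FODef k n p) (hpq : ∀ w x, p w x ↔ q w x) : FODef k n q := by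
  obtain ⟨φ, hφ, h⟩ := h
  exact ⟨φ, hφ, fun w x => (h w x).trans (hpq w x)⟩

theorem false : FODef (B := B) k n fun _ _ => False :=
  ⟨⊥, Nat.zero_le _, fun _ _ => BoundedFormula.realize_bot⟩

theorem imp (hp : FODef k n p) (hq : FODef k n q) : FODef k n fun w x => p w x → q w x := by
  obtain ⟨φ, hφ, h⟩ := hp
  obtain ⟨ψ, hψ, h'⟩ := hq
  exact ⟨φ.imp ψ, max_le hφ hψ, fun w x => by rw [BoundedFormula.realize_imp, h, h']⟩

theorem not (hp : FODef k n p) : FODef k n fun w x => ¬ p w x := hp.imp false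

theorem true : FODef (B := B) k n fun _ _ => True := false.not.congr (by simp)

theorem const (c : Prop) : FODef (B := B) k n fun _ _ => c := by
  by_cases h : c
  · exact true.congr (by simp [h])
  · exact false.congr (by simp [h])

theorem and (hp : FODef k n p) (hq : FODef k n q) : FODef k n fun w x => p w x ∧ q w x :=
  (hp.imp hq.not).not.congr (by simp)

theorem iff (hp : FODef k n p) (hq : FODef k n q) : FODef k n fun w x => p w x ↔ q w x :=
  ((hp.imp hq).and (hq.imp hp)).congr fun _ _ => iff_def.symm

theorem forall_finite {ι : Type*} [Finite ι]
    {p : ι → (w : FreeSemigroup B) → (Fin n → Pos w) → Prop} (hp : ∀ i, FODef k n (p i)) :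
    FODef k n fun w x => ∀ i, p i w x := by
  cases nonempty_fintype ι
  suffices h : ∀ s : Finset ι, FODef k n fun w x => ∀ i ∈ s, p i w x from
    (h Finset.univ).congr (by simp)
  intro s
  classical
  induction s using Finset.induction_on with
  | empty => exact true.congr (by simp)
  | insert i s _ ih => exact ((hp i).and ih).congr (by simp)

theorem forall_pos {p : (w : FreeSemigroup B) → (Fin (n + 1) → Pos w) → Prop}
    (hp : FODef k (n + 1) p) : FODef (k + 1) n fun w x => ∀ i, p w (Fin.snoc x i) := by
  obtain ⟨φ, hφ, h⟩ := hp
  exact ⟨φ.all, Nat.succ_le_succ hφ, fun w x => by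
    rw [BoundedFormula.realize_all]
    exact forall_congr' fun i => h w _⟩

theorem exists_pos {p : (w : FreeSemigroup B) → (Fin (n + 1) → Pos w) → Prop}
    (hp : FODef k (n + 1) p) : FODef (k + 1) n fun w x => ∃ i, p w (Fin.snoc x i) :=
  hp.not.forall_pos.not.congr (by simp)

theorem letter (b : B) (i : Fin n) : FODef k n fun w x => (letters w).get (x i) = b :=
  ⟨.rel (WordRel.letter b) fun _ => Term.var (Sum.inr i), Nat.zero_le _, fun _ _ => Iff.rfl⟩

theorem lt (i j : Fin n) : FODef (B := B) k n fun _ x => Fin.val (x i) < Fin.val (x j) :=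
  ⟨.rel WordRel.lt ![Term.var (Sum.inr i), Term.var (Sum.inr j)], Nat.zero_le _,
    fun _ _ => Iff.rfl⟩

end FODef

/-- The first position after the variable `o`, or after the start of the word. -/
def lo {n : ℕ} (o : Option (Fin n)) {w : FreeSemigroup B} (x : Fin n → Pos w) : ℕ :=
  o.elim 0 fun i => Fin.val (x i) + 1

/-- The position of the variable `o`, or the end of the word. -/
def hi {n : ℕ} (o : Option (Fin n)) {w : FreeSemigroup B} (x : Fin n → Pos w) : ℕ :=
  o.elim (letters w).length fun i => Fin.val (x i)

theorem lo_snoc {n : ℕ} (o : Option (Fin n)) {w : FreeSemigroup B} (x : Fin n → Pos w)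
    (i : Pos w) : lo (o.map Fin.castSucc) (Fin.snoc (α := fun _ => Pos w) x i) = lo o x := by
  cases o <;> simp [lo]

theorem hi_snoc {n : ℕ} (o : Option (Fin n)) {w : FreeSemigroup B} (x : Fin n → Pos w)
    (i : Pos w) : hi (o.map Fin.castSucc) (Fin.snoc (α := fun _ => Pos w) x i) = hi o x := by
  cases o <;> simp [hi]

theorem lo_last {n : ℕ} {w : FreeSemigroup B} (x : Fin n → Pos w) (i : Pos w) :
    lo (some (Fin.last n)) (Fin.snoc (α := fun _ => Pos w) x i) = Fin.val i + 1 := by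
  simp [lo]

theorem hi_last {n : ℕ} {w : FreeSemigroup B} (x : Fin n → Pos w) (i : Pos w) :
    hi (some (Fin.last n)) (Fin.snoc (α := fun _ => Pos w) x i) = Fin.val i := by
  simp [hi]

theorem FODef.lo_le {k n : ℕ} (o : Option (Fin n)) (j : Fin n) :
    FODef (B := B) k n fun _ x => lo o x ≤ Fin.val (x j) := by
  cases o with
  | none => exact FODef.true.congr (by simp [lo])
  | some i => exact (FODef.lt i j).congr fun _ _ => Nat.lt_iff_add_one_le

theorem FODef.lt_hi {k n : ℕ} (o : Option (Fin n)) (j : Fin n) :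
    FODef (B := B) k n fun _ x => Fin.val (x j) < hi o x := by
  cases o with
  | none => exact FODef.true.congr fun w x => (iff_true_intro (x j).isLt).symm
  | some i => exact FODef.lt j i

theorem FODef.tp_seg [Finite B] {k n : ℕ} (l h : Option (Fin n)) (τ : Ty B k) :
    FODef k n fun w x => tp k (seg (letters w) (lo l x) (hi h x)) = τ := by
  induction k generalizing n with
  | zero => exact FODef.true.congr fun _ _ => (iff_true_intro rfl).symm
  | succ k ih =>
    -- A type of rank `k + 1` is a set of triples, and there are finitely many triples. Fixing it is
    -- thus a finite conjunction, each conjunct spending one quantifier on the position that splits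
    -- the factor.
    have key : ∀ t : Ty B k × B × Ty B k, FODef (k + 1) n fun w x =>
        (∃ i : Pos w, lo l x ≤ Fin.val i ∧ Fin.val i < hi h x ∧
          tp k (seg (letters w) (lo l x) (Fin.val i)) = t.1 ∧ (letters w).get i = t.2.1 ∧
          tp k (seg (letters w) (Fin.val i + 1) (hi h x)) = t.2.2) ↔
        (show Set (Ty B k × B × Ty B k) from τ) t := by
      intro t
      refine FODef.iff ?_ (FODef.const _)
      have := (FODef.lo_le (B := B) (k := k) (l.map Fin.castSucc) (Fin.last n)).and
        ((FODef.lt_hi (h.map Fin.castSucc) (Fin.last n)).and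
        ((ih (l.map Fin.castSucc) (some (Fin.last n)) t.1).and
        ((FODef.letter t.2.1 (Fin.last n)).and
        (ih (some (Fin.last n)) (h.map Fin.castSucc) t.2.2))))
      refine this.exists_pos.congr fun w x => exists_congr fun i => ?_
      rw [lo_snoc, hi_snoc, lo_last, hi_last]
      simp only [Fin.snoc_last]
    refine (FODef.forall_finite key).congr fun w x => ?_
    refine Iff.trans (forall_congr' fun t => ?_)
      (Set.ext_iff (a := show Set (Ty B k × B × Ty B k) from _)
        (b := show Set (Ty B k × B × Ty B k) from τ)).symm
    refine iff_congr ?_ Iff.rfl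
    refine Iff.trans ?_ mem_tp_seg.symm
    exact ⟨fun ⟨i, e⟩ => ⟨i.1, i.2, e⟩, fun ⟨i, hi, e⟩ => ⟨⟨i, hi⟩, e⟩⟩

/-- The words of a given rank `k` type are defined by a sentence of quantifier rank at most `k`. -/
theorem exists_sentence_tp_eq [Finite B] (k : ℕ) (τ : Ty B k) :
    ∃ φ : (wordLang B).Sentence, definedBy φ = {w | tp k (letters w) = τ} ∧ qrank φ ≤ k := by
  obtain ⟨φ, hφ, h⟩ := FODef.tp_seg (B := B) (n := 0) none none τ
  refine ⟨φ, Set.ext fun w => (h w default).trans ?_, hφ⟩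
  simp [lo, hi, seg]

end Definability

/-! ### Products of words of subsets -/

section Evaluation

variable {S : Type v} [Semigroup S]

/-- The product of a nonempty word of subsets of `S`; the value at the empty word is irrelevant. -/
def ev : List (Set S) → Set S
  | [] => ∅
  | [a] => a
  | a :: b :: l => a * ev (b :: l)

theorem ev_singleton (a : Set S) : ev [a] = a := rfl

theorem ev_cons {a : Set S} {l : List (Set S)} (hl : l ≠ []) : ev (a :: l) = a * ev l := by
  cases l with
  | nil => exact absurd rfl hl
  | cons b l => rfl

theorem ev_append {u v : List (Set S)} (hu : u ≠ []) (hv : v ≠ []) :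
    ev (u ++ v) = ev u * ev v := by
  induction u with
  | nil => exact absurd rfl hu
  | cons a u ih =>
    cases u with
    | nil => exact ev_cons hv
    | cons b u =>
      have h : b :: u ≠ [] := List.cons_ne_nil _ _
      rw [List.cons_append, ev_cons (by simp), ih h, ev_cons h, mul_assoc]

theorem ev_mem {M : Set (Set S)} (hM : ∀ a ∈ M, ∀ b ∈ M, a * b ∈ M) {w : List (Set S)}
    (hne : w ≠ []) (hw : ∀ a ∈ w, a ∈ M) : ev w ∈ M := by
  induction w with
  | nil => exact absurd rfl hne
  | cons a w ih =>
    rcases eq_or_ne w [] with rfl | h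
    · exact hw a (by simp)
    · rw [ev_cons h]
      exact hM _ (hw a (by simp)) _ (ih h fun b hb => hw b (by simp [hb]))

theorem ev_flatten {Z : List (List (Set S))} (hZ : ∀ z ∈ Z, z ≠ []) (hne : Z ≠ []) :
    ev Z.flatten = ev (Z.map ev) := by
  induction Z with
  | nil => exact absurd rfl hne
  | cons z Z ih =>
    rcases eq_or_ne Z [] with rfl | h
    · simp [ev_singleton]
    · have hz := hZ z (by simp)
      have hZ' : ∀ z ∈ Z, z ≠ [] := fun y hy => hZ y (by simp [hy])
      have hf : Z.flatten ≠ [] := by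
        obtain ⟨y, hy⟩ := List.exists_mem_of_ne_nil Z h
        intro h0
        exact hZ' y hy (List.flatten_eq_nil_iff.1 h0 y hy)
      rw [List.flatten_cons, ev_append hz hf, ih hZ' h, List.map_cons, ev_cons (by simpa using h)]

theorem ev_map_mono {ι : Type*} {f g : ι → Set S} {l : List ι} (h : ∀ i ∈ l, f i ⊆ g i) :
    ev (l.map f) ⊆ ev (l.map g) := by
  induction l with
  | nil => simp
  | cons i l ih =>
    rcases eq_or_ne l [] with rfl | hl
    · simpa [ev_singleton] using h
    · rw [List.map_cons, List.map_cons, ev_cons (by simpa using hl), ev_cons (by simpa using hl)]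
      exact Set.mul_subset_mul (h i (by simp)) (ih fun j hj => h j (by simp [hj]))

end Evaluation

/-! ### Saturation and the tame case -/

section Saturation

variable {S : Type v} [Semigroup S]

theorem MemSat.of_forall_mem {𝒮 𝒯 : Subsemigroup (Set S)} (h : ∀ T ∈ 𝒮, MemSat 𝒯 T) {T : Set S}
    (hT : MemSat 𝒮 T) : MemSat 𝒯 T := by
  induction hT with
  | base hT => exact h _ hT
  | downset _ hs ih => exact ih.downset hs
  | mul _ _ ih ih' => exact ih.mul ih'
  | foClosure _ n hn ih => exact ih.foClosure n hn

/-- Saturating is idempotent. This brings bounds found over the block alphabet back to the original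
semigroup. -/
theorem MemSat.of_closure {A : Set (Set S)} {𝒯 : Subsemigroup (Set S)} (h : ∀ T ∈ A, MemSat 𝒯 T)
    {T : Set S} (hT : MemSat (Subsemigroup.closure A) T) : MemSat 𝒯 T := by
  refine MemSat.of_forall_mem (fun T hT => ?_) hT
  induction hT using Subsemigroup.closure_induction with
  | mem T hT => exact h T hT
  | mul T T' _ _ ih ih' => exact ih.mul ih'

theorem spow_mem {M : Set (Set S)} (hM : ∀ a ∈ M, ∀ b ∈ M, a * b ∈ M) {T : Set S} (hT : T ∈ M)
    (n : ℕ+) : spow T n ∈ M := by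
  induction n using PNat.recOn with
  | one => exact hT
  | succ n ih => rw [spow_succ]; exact hM _ ih _ hT

/-- A finite semigroup of sets that is closed under `T ↦ T ^ ω ∪ T ^ (ω + 1)` has a member that
absorbs all the others. -/
theorem exists_absorbing [Finite S] {M : Set (Set S)} (hne : M.Nonempty)
    (hmul : ∀ a ∈ M, ∀ b ∈ M, a * b ∈ M)
    (hfo : ∀ T ∈ M, ∀ n, IsIdempotentElem (spow T n) → spow T n ∪ spow T (n + 1) ∈ M) :
    ∃ e ∈ M, ∀ T ∈ M, e * T * e ⊆ e := by
  obtain ⟨T₀, hT₀⟩ := hne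
  obtain ⟨n₀, hn₀⟩ := exists_idempotent_spow T₀
  -- By minimality of `e M e` this local monoid is a group with unit `e`; `hpow` expresses this
  -- through idempotent powers.
  obtain ⟨e, ⟨heM, he⟩, hmin⟩ := Set.Finite.exists_minimalFor
    (fun e : Set S => (fun x => e * x * e) '' M) {e | e ∈ M ∧ IsIdempotentElem e}
    (Set.toFinite _) ⟨_, spow_mem hmul hT₀ n₀, hn₀⟩
  have he' : e * e = e := he
  have hpow : ∀ X ∈ M, e * X = X → X * e = X → ∀ n, IsIdempotentElem (spow X n) →
      spow X n = e := by
    intro X hX h1 h2 n hn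
    have hl : e * spow X n = spow X n := by
      clear hn
      induction n using PNat.recOn with
      | one => exact h1
      | succ n ih => rw [spow_succ, ← mul_assoc, ih]
    have hr : spow X n * e = spow X n := by
      cases n using PNat.recOn with
      | one => exact h2
      | succ n => rw [spow_succ, mul_assoc, h2]
    obtain ⟨y, hy, hye⟩ := hmin ⟨spow_mem hmul hX n, hn⟩ (by
      rintro _ ⟨y, hy, rfl⟩
      refine ⟨spow X n * y * spow X n,
        hmul _ (hmul _ (spow_mem hmul hX n) _ hy) _ (spow_mem hmul hX n), ?_⟩
      simp only
      rw [mul_assoc, mul_assoc _ _ e, hr, ← mul_assoc, ← mul_assoc, hl]) ⟨e, heM, rfl⟩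
    simp only at hye
    rw [he', he'] at hye
    have hn' : spow X n * spow X n = spow X n := hn
    have h3 : spow X n * e = e := by
      rw [← hye, ← mul_assoc, ← mul_assoc, hn']
    rw [← hr, h3]
  refine ⟨e, heM, fun T hT => ?_⟩
  set X := e * T * e with hXdef
  have hX : X ∈ M := hmul _ (hmul _ heM _ hT) _ heM
  have hl : e * X = X := by rw [hXdef, ← mul_assoc, ← mul_assoc, he']
  have hr : X * e = X := by rw [hXdef, mul_assoc, he']
  obtain ⟨n, hn⟩ := exists_idempotent_spow X
  have hV := hfo X hX n hn
  -- Since `X ^ ω = e`, FO-closure yields `V = e ∪ X` in `M`. As `V = V e` and `e ⊆ V`, the powers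
  -- of `V` all contain `V`, while its idempotent power is again `e`; so `X ⊆ V ⊆ e`.
  rw [spow_succ, hpow X hX hl hr n hn, hl] at hV
  obtain ⟨m, hm⟩ := exists_idempotent_spow (e ∪ X)
  have hVr : (e ∪ X) * e = e ∪ X := by rw [Set.union_mul, he', hr]
  have hsub : ∀ m, e ∪ X ⊆ spow (e ∪ X) m := by
    intro m
    induction m using PNat.recOn with
    | one => exact subset_rfl
    | succ m ih =>
      rw [spow_succ]
      calc e ∪ X = (e ∪ X) * e := hVr.symm
        _ ⊆ spow (e ∪ X) m * (e ∪ X) := Set.mul_subset_mul ih Set.subset_union_left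
  have hVl : e * (e ∪ X) = e ∪ X := by rw [Set.mul_union, he', hl]
  have := hsub m
  rw [hpow _ hV hVl hVr m hm] at this
  exact Set.subset_union_right.trans this

/-- If every letter acts on `⋃₀ 𝒮` from the left and from the right without loss, then `⋃₀ 𝒮`
belongs to the saturation. -/
theorem MemSat.sUnion_of_tame [Finite S] {A : Set (Set S)} (hne : A.Nonempty)
    (hl : ∀ a ∈ A, a * ⋃₀ (Subsemigroup.closure A : Set (Set S)) =
      ⋃₀ (Subsemigroup.closure A : Set (Set S)))
    (hr : ∀ a ∈ A, ⋃₀ (Subsemigroup.closure A : Set (Set S)) * a =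
      ⋃₀ (Subsemigroup.closure A : Set (Set S))) :
    MemSat (Subsemigroup.closure A) (⋃₀ (Subsemigroup.closure A : Set (Set S))) := by
  set 𝒮 := Subsemigroup.closure A with h𝒮
  set R := ⋃₀ (𝒮 : Set (Set S)) with hR
  have hM : ∀ T ∈ 𝒮, T * R = R ∧ R * T = R := by
    intro T hT
    induction hT using Subsemigroup.closure_induction with
    | mem T hT => exact ⟨hl T hT, hr T hT⟩
    | mul T T' _ _ ih ih' =>
      exact ⟨by rw [mul_assoc, ih'.1, ih.1], by rw [← mul_assoc, ih.2, ih'.2]⟩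
  obtain ⟨a, ha⟩ := hne
  -- Stabilising `R` on both sides survives products and unions, so the absorbing element `e` will
  -- satisfy `R = e R e`.
  have hmul : ∀ T ∈ {T | MemSat 𝒮 T ∧ T * R = R ∧ R * T = R},
      ∀ T' ∈ {T | MemSat 𝒮 T ∧ T * R = R ∧ R * T = R},
      T * T' ∈ {T | MemSat 𝒮 T ∧ T * R = R ∧ R * T = R} := by
    rintro T ⟨h1, h2, h3⟩ T' ⟨h1', h2', h3'⟩
    exact ⟨h1.mul h1', by rw [mul_assoc, h2', h2], by rw [← mul_assoc, h3, h3']⟩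
  obtain ⟨e, ⟨he, hel, her⟩, habs⟩ := exists_absorbing
    (M := {T | MemSat 𝒮 T ∧ T * R = R ∧ R * T = R})
    ⟨a, .base (Subsemigroup.subset_closure ha), hl a ha, hr a ha⟩ hmul (by
      rintro T hT n hn
      obtain ⟨-, h2, h3⟩ := spow_mem hmul hT n
      obtain ⟨-, h2', h3'⟩ := spow_mem hmul hT (n + 1)
      exact ⟨hT.1.foClosure n hn, by rw [Set.union_mul, h2, h2', Set.union_self],
        by rw [Set.mul_union, h3, h3', Set.union_self]⟩)
  refine he.downset fun r hr' => ?_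
  rw [← her, ← hel] at hr'
  obtain ⟨_, ⟨x, hx, y, ⟨T, hT, hy⟩, rfl⟩, z, hz, rfl⟩ := hr'
  exact habs T ⟨.base hT, hM T hT⟩ (Set.mul_mem_mul (Set.mul_mem_mul hx hy) hz)

end Saturation

/-! ### Powers of a single letter -/

section Runs

variable {S : Type v} [Semigroup S]

theorem ev_replicate (b : Set S) (n : ℕ+) : ev (List.replicate n b) = spow b n := by
  induction n using PNat.recOn with
  | one => rfl
  | succ n ih =>
    rw [PNat.add_coe, PNat.one_coe, List.replicate_add, ev_append (by simp) (by simp), ih,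
      spow_succ]
    rfl

theorem spow_mul_of_isIdempotentElem {X : Type u} [Semigroup X] {s : X} {n : ℕ+}
    (hn : IsIdempotentElem (spow s n)) (k : ℕ+) : spow s (n * k) = spow s n := by
  induction k using PNat.recOn with
  | one => rw [mul_one]
  | succ k ih => rw [mul_add, mul_one, spow_add, ih, hn]

/-- The powers of `b` with a large exponent have a common upper bound in the saturation. -/
theorem MemSat.exists_bound_spow [Finite S] {𝒮 : Subsemigroup (Set S)} {b R : Set S}
    (hb : MemSat 𝒮 b) (hbR : b ⊆ R) (hR : R * R ⊆ R) :
    ∃ U, MemSat 𝒮 U ∧ ∀ i : ℕ+, 2 ^ R.ncard ≤ (i : ℕ) → spow b i ⊆ U := by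
  have hpow : ∀ n, spow b n ⊆ R := by
    intro n
    induction n using PNat.recOn with
    | one => exact hbR
    | succ n ih => rw [spow_succ]; exact (Set.mul_subset_mul ih hbR).trans hR
  have hsat : ∀ {T}, MemSat 𝒮 T → ∀ n, MemSat 𝒮 (spow T n) := fun hT n =>
    spow_mem (M := {T | MemSat 𝒮 T}) (fun _ h _ h' => h.mul h') hT n
  -- Pigeonhole: the exponents `1, …, 2 ^ |R| + 1` outnumber the subsets of `R`.
  obtain ⟨p, d, hp, hpd⟩ : ∃ p d : ℕ+, (p : ℕ) ≤ 2 ^ R.ncard ∧ spow b (p + d) = spow b p := by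
    obtain ⟨x, hx, y, hy, hne, h⟩ := Set.exists_ne_map_eq_of_ncard_lt_of_maps_to
      (s := Set.Iio (2 ^ R.ncard + 1)) (t := 𝒫 R) (f := fun i => spow b i.succPNat)
      (by
        rw [Set.ncard_powerset R, ← Nat.card_coe_set_eq (Set.Iio _), Nat.card_eq_fintype_card]
        simp)
      (fun _ _ => hpow _) (Set.toFinite _)
    rw [Set.mem_Iio] at hx hy
    rcases lt_or_gt_of_ne hne with hlt | hlt
    · refine ⟨x.succPNat, ⟨y - x, by omega⟩, by simp; omega, ?_⟩
      rw [h]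
      congr 1
      refine PNat.eq ?_
      change _ + 1 + (_ - _) = _ + 1
      omega
    · refine ⟨y.succPNat, ⟨x - y, by omega⟩, by simp; omega, ?_⟩
      rw [← h]
      congr 1
      refine PNat.eq ?_
      change _ + 1 + (_ - _) = _ + 1
      omega
  obtain ⟨ν, hν⟩ := exists_idempotent_spow b
  set e := spow b ν with he
  have hee : e * e = e := hν
  have hper : ∀ i : ℕ+, p ≤ i → spow b i * e = spow b i := by
    have h1 : ∀ k : ℕ+, spow b (p + k * d) = spow b p := by
      intro k
      induction k using PNat.recOn with
      | one => rw [one_mul, hpd]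
      | succ k ih =>
        rw [add_mul, one_mul, ← add_assoc, add_right_comm, spow_add, hpd, ← spow_add, ih]
    have h2 : spow b p * e = spow b p := by
      rw [he, ← spow_mul_of_isIdempotentElem hν d, ← spow_add, h1]
    have hcomm : ∀ m n : ℕ+, spow b m * spow b n = spow b n * spow b m := fun m n => by
      rw [← spow_add, ← spow_add, add_comm]
    intro i hi
    rcases hi.eq_or_lt with rfl | hlt
    · exact h2
    · obtain ⟨t, rfl⟩ : ∃ t, i = p + t := ⟨i - p, (PNat.add_sub_of_lt hlt).symm⟩
      rw [spow_add, mul_assoc, hcomm t ν, ← mul_assoc, h2]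
  -- The powers of `T` increase because `e ⊆ T = e T`, and `T ^ i` contains `b ^ i e` because `b e ⊆
  -- T`. The bound is therefore the idempotent power of `T`.
  set T := e ∪ spow b (ν + 1) with hT
  have hTsat : MemSat 𝒮 T := hb.foClosure ν hν
  have heb : spow b (ν + 1) = e * b := spow_succ b ν
  have hbe : b * e = e * b := by
    rw [he, ← spow_succ, add_comm, spow_add]; rfl
  have heT : e * T = T := by rw [hT, heb, Set.mul_union, ← mul_assoc, hee]
  have hpowe : ∀ i : ℕ+, spow b i * e ⊆ spow T i := by
    intro i
    induction i using PNat.recOn with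
    | one => rw [spow_one, spow_one, hbe, ← heb]; exact Set.subset_union_right
    | succ i ih =>
      have : spow b (i + 1) * e = (spow b i * e) * (e * b) := by
        rw [spow_succ, mul_assoc, hbe, mul_assoc, ← mul_assoc e e, hee]
      rw [this, spow_succ, ← heb]
      exact Set.mul_subset_mul ih Set.subset_union_right
  have hTT : ∀ i : ℕ+, spow T i ⊆ spow T (i + 1) := by
    intro i
    have hl : e * spow T i = spow T i := by
      induction i using PNat.recOn with
      | one => exact heT
      | succ i ih => rw [spow_succ, ← mul_assoc, ih]
    rw [add_comm, spow_add]
    calc spow T i = e * spow T i := hl.symm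
      _ ⊆ spow T 1 * spow T i := Set.mul_subset_mul_right Set.subset_union_left
  have hmono : ∀ i k : ℕ+, spow T i ⊆ spow T (i + k) := by
    intro i k
    induction k using PNat.recOn with
    | one => exact hTT i
    | succ k ih => exact ih.trans (by rw [← add_assoc]; exact hTT _)
  obtain ⟨m, hm⟩ := exists_idempotent_spow T
  refine ⟨spow T m, hsat hTsat m, fun i hi => ?_⟩
  rw [← hper i (PNat.coe_le_coe _ _ |>.1 (hp.trans hi)), ← hm, ← spow_mul_of_isIdempotentElem hm i]
  refine (hpowe i).trans ?_
  rw [← spow_add]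
  -- The exponent is doubled so that it strictly exceeds `i`, as subtraction of positive integers
  -- demands.
  have : m * i + m * i = i + (m * i + m * i - i) := by
    refine (PNat.add_sub_of_lt ?_).symm
    rw [← PNat.coe_lt_coe]
    have := m.pos
    have := i.pos
    push_cast
    nlinarith
  rw [this]
  exact hmono _ _

end Runs

/-! ### Cutting words into blocks -/

section Decomposition

variable {α : Type u} {P : α → Prop}

/-- The words of `P* N⁺`, where `N` is the complement of `P`. -/
def Lead (P : α → Prop) (z : List α) : Prop :=
  ∃ x y, z = x ++ y ∧ (∀ a ∈ x, P a) ∧ (∀ a ∈ y, ¬ P a) ∧ y ≠ []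

/-- The words of `P⁺ N⁺`, where `N` is the complement of `P`. -/
def Block (P : α → Prop) (z : List α) : Prop :=
  ∃ x y, z = x ++ y ∧ (∀ a ∈ x, P a) ∧ (∀ a ∈ y, ¬ P a) ∧ x ≠ [] ∧ y ≠ []

/-- The decomposition of a word along `P* N⁺ (P⁺ N⁺)* P*`, where `N` is the complement of `P`. -/
structure Dec (P : α → Prop) (w z₀ : List α) (Z : List (List α)) (z₁ : List α) : Prop where
  eq : w = z₀ ++ (Z.flatten ++ z₁)
  lead : Lead P z₀
  block : ∀ z ∈ Z, Block P z
  last : ∀ a ∈ z₁, P a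

/-- The words whose last letter exists and does not satisfy `P`. -/
def EndN (P : α → Prop) (u : List α) : Prop := ∃ t n, u = t ++ [n] ∧ ¬ P n

/-- The words whose first letter, if it exists, satisfies `P`. -/
def HeadP (P : α → Prop) (r : List α) : Prop := ∀ a s, r = a :: s → P a

theorem exists_eq_append_singleton {l : List α} (h : l ≠ []) : ∃ t a, l = t ++ [a] :=
  ⟨l.dropLast, l.getLast h, (List.dropLast_append_getLast h).symm⟩

theorem Block.lead {z : List α} (h : Block P z) : Lead P z := by
  obtain ⟨x, y, h1, h2, h3, -, h4⟩ := h
  exact ⟨x, y, h1, h2, h3, h4⟩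

theorem Block.exists_cons {z : List α} (h : Block P z) : ∃ a y, z = a :: y ∧ P a ∧ Lead P y := by
  obtain ⟨x, y, rfl, h2, h3, h4, h5⟩ := h
  obtain ⟨a, x, rfl⟩ := List.exists_cons_of_ne_nil h4
  exact ⟨a, x ++ y, rfl, h2 a (by simp), x, y, rfl, fun b hb => h2 b (by simp [hb]), h3, h5⟩

theorem Block.ne_nil {z : List α} (h : Block P z) : z ≠ [] := by
  obtain ⟨a, y, rfl, -⟩ := h.exists_cons
  simp

theorem Lead.endN {z : List α} (h : Lead P z) : EndN P z := by
  obtain ⟨x, y, rfl, -, h3, h4⟩ := h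
  obtain ⟨t, n, rfl⟩ := exists_eq_append_singleton h4
  exact ⟨x ++ t, n, by simp, h3 n (by simp)⟩

theorem EndN.append_left {u : List α} (h : EndN P u) (v : List α) : EndN P (v ++ u) := by
  obtain ⟨t, n, rfl, hn⟩ := h
  exact ⟨v ++ t, n, by simp, hn⟩

theorem EndN.of_append {u v : List α} (h : EndN P (u ++ v)) (hv : v ≠ []) : EndN P v := by
  obtain ⟨t, n, e, hn⟩ := h
  obtain ⟨t', n', rfl⟩ := exists_eq_append_singleton hv
  rw [← List.append_assoc] at e
  obtain ⟨-, e⟩ := List.append_inj' e rfl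
  obtain rfl : n' = n := by simpa using e
  exact ⟨t', n', by simp, hn⟩

theorem EndN.exists_mem {u : List α} (h : EndN P u) : ∃ a ∈ u, ¬ P a := by
  obtain ⟨t, n, rfl, hn⟩ := h
  exact ⟨n, by simp, hn⟩

theorem EndN.append_flatten {u : List α} (h : EndN P u) {Z : List (List α)}
    (hZ : ∀ z ∈ Z, Block P z) : EndN P (u ++ Z.flatten) := by
  induction Z generalizing u with
  | nil => simpa using h
  | cons z Z ih =>
    rw [List.flatten_cons, ← List.append_assoc]
    exact ih ((hZ z (by simp)).lead.endN.append_left u) fun y hy => hZ y (by simp [hy])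

theorem Lead.not_of_mem {t s : List α} {n : α} (h : Lead P (t ++ n :: s)) (hn : ¬ P n) :
    ∀ a ∈ s, ¬ P a := by
  obtain ⟨x, y, e, h2, h3, -⟩ := h
  intro a ha
  rcases List.append_eq_append_iff.1 e with ⟨r, rfl, e'⟩ | ⟨r, rfl, rfl⟩
  · rcases List.cons_eq_append_iff.1 e' with ⟨rfl, rfl⟩ | ⟨r, rfl, rfl⟩
    · exact h3 a (by simp [ha])
    · exact absurd (h2 n (by simp)) hn
  · exact h3 a (by simp [ha])

theorem Lead.not_endN {U bs : List α} {a : α} (h : Lead P (U ++ a :: bs)) (hU : EndN P U) :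
    ¬ P a := by
  obtain ⟨t, n, rfl, hn⟩ := hU
  rw [List.append_assoc] at h
  exact h.not_of_mem hn a (by simp)

theorem Dec.headP {w z₀ z₁ : List α} {Z : List (List α)} (h : Dec P w z₀ Z z₁) :
    HeadP P (Z.flatten ++ z₁) := by
  intro a s e
  cases Z with
  | nil => exact h.last a (by simp at e; simp [e])
  | cons z Z =>
    obtain ⟨b, y, rfl, hb, -⟩ := (h.block z (by simp)).exists_cons
    simp only [List.flatten_cons, List.cons_append, List.cons.injEq] at e
    exact e.1 ▸ hb

theorem exists_dec {w : List α} (hw : ∃ a ∈ w, ¬ P a) : ∃ z₀ Z z₁, Dec P w z₀ Z z₁ := by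
  induction w with
  | nil => simp at hw
  | cons a w ih =>
    by_cases hw' : ∃ a ∈ w, ¬ P a
    · obtain ⟨z₀, Z, z₁, rfl, ⟨x, y, rfl, h2, h3, h4⟩, h5, h6⟩ := ih hw'
      by_cases ha : P a
      · refine ⟨(a :: x) ++ y, Z, z₁, by simp, ⟨_, _, rfl, ?_, h3, h4⟩, h5, h6⟩
        simpa [ha] using h2
      · rcases eq_or_ne x [] with rfl | hx
        · refine ⟨a :: y, Z, z₁, by simp, ⟨[], a :: y, rfl, by simp, ?_, by simp⟩, h5, h6⟩
          simpa [ha] using h3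
        -- A cut appears after `a`: the former leading part starts with a letter of `P`, so it
        -- becomes the first block.
        · refine ⟨[a], (x ++ y) :: Z, z₁, by simp, ⟨[], [a], rfl, by simp, by simpa, by simp⟩, ?_, h6⟩
          simpa using ⟨⟨x, y, rfl, h2, h3, hx, h4⟩, h5⟩
    · push Not at hw'
      obtain ⟨b, hb, hb'⟩ := hw
      obtain rfl : b = a := by
        rcases List.mem_cons.1 hb with h | h
        · exact h
        · exact absurd (hw' b h) hb'
      exact ⟨[b], [], w, by simp, ⟨[], [b], rfl, by simp, by simpa, by simp⟩, by simp, hw'⟩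

/-- The last letter that violates a predicate is at a unique position. -/
theorem eq_of_append_cons_eq {q : α → Prop} {t t' z z' : List α} {n n' : α}
    (h : t ++ n :: z = t' ++ n' :: z') (hn : ¬ q n) (hn' : ¬ q n') (hz : ∀ a ∈ z, q a)
    (hz' : ∀ a ∈ z', q a) : t = t' ∧ n = n' ∧ z = z' := by
  rcases List.append_eq_append_iff.1 h with ⟨r, rfl, e⟩ | ⟨r, rfl, e⟩
  · rcases List.cons_eq_append_iff.1 e with ⟨rfl, e⟩ | ⟨r, rfl, rfl⟩
    · simp_all
    · exact absurd (hz n' (by simp)) hn'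
  · rcases List.cons_eq_append_iff.1 e with ⟨rfl, e⟩ | ⟨r, rfl, rfl⟩
    · simp_all
    · exact absurd (hz' n (by simp)) hn

/-- A position between a letter outside `P` and a letter of `P` is the start of a block, or of the
last part. -/
theorem exists_block_of_cut {z₀ z₁ U V : List α} {Z : List (List α)} {a : α}
    (hl : Lead P z₀) (hZ : ∀ z ∈ Z, Block P z) (hz : ∀ a ∈ z₁, P a)
    (h : z₀ ++ (Z.flatten ++ z₁) = U ++ a :: V) (hU : EndN P U) (ha : P a)
    (hV : ∃ b ∈ V, ¬ P b) :
    ∃ X y Y, Z = X ++ (a :: y) :: Y ∧ U = z₀ ++ X.flatten ∧ V = y ++ (Y.flatten ++ z₁) := by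
  obtain ⟨b, hbV, hb⟩ := hV
  induction Z generalizing z₀ U with
  | nil =>
    exfalso
    rw [List.flatten_nil, List.nil_append] at h
    rcases List.append_eq_append_iff.1 h with ⟨r, rfl, rfl⟩ | ⟨r, rfl, e⟩
    · exact hb (hz b (by simp [hbV]))
    · rcases List.cons_eq_append_iff.1 e with ⟨rfl, rfl⟩ | ⟨r, rfl, rfl⟩
      · exact hb (hz b (by simp [hbV]))
      · exact hl.not_endN hU ha
  | cons z Z ih =>
    have hzb := hZ z (by simp)
    have start : (z :: Z).flatten ++ z₁ = a :: V →
        ∃ y, z :: Z = (a :: y) :: Z ∧ V = y ++ (Z.flatten ++ z₁) := by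
      intro e
      obtain ⟨c, y, rfl, -, -⟩ := hzb.exists_cons
      simp only [List.flatten_cons, List.cons_append, List.append_assoc, List.cons.injEq] at e
      obtain ⟨rfl, rfl⟩ := e
      exact ⟨y, rfl, rfl⟩
    rcases List.append_eq_append_iff.1 h with ⟨r, rfl, e⟩ | ⟨r, rfl, e⟩
    · rcases eq_or_ne r [] with rfl | hr
      · obtain ⟨y, e1, e2⟩ := start e
        exact ⟨[], y, Z, e1, by simp, e2⟩
      · rw [List.flatten_cons, List.append_assoc] at e
        obtain ⟨X, y, Y, rfl, rfl, e3⟩ := ih hzb.lead (fun y hy => hZ y (by simp [hy])) e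
          (hU.of_append hr)
        exact ⟨z :: X, y, Y, rfl, by simp, e3⟩
    · rcases List.cons_eq_append_iff.1 e with ⟨rfl, e⟩ | ⟨r, rfl, e⟩
      · obtain ⟨y, e1, e2⟩ := start (by simpa using e.symm)
        exact ⟨[], y, Z, e1, by simp, e2⟩
      · exact absurd ha (hl.not_endN hU)

theorem EndN.of_tp {k : ℕ} {u u' : List α} (hu : EndN P u) (h : tp (k + 2) u = tp (k + 2) u') :
    EndN P u' := by
  obtain ⟨t, n, rfl, hn⟩ := hu
  obtain ⟨t', v', rfl, -, e⟩ := tp_succ_split h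
  obtain rfl := eq_nil_of_tp e
  exact ⟨t', n, rfl, hn⟩

theorem HeadP.of_tp {k : ℕ} {r r' : List α} (hr : HeadP P r) (h : tp (k + 2) r = tp (k + 2) r') :
    HeadP P r' := by
  rintro a s rfl
  obtain ⟨u, v, rfl, e, -⟩ := tp_succ_split (u := []) h.symm
  obtain rfl := eq_nil_of_tp e
  exact hr a v rfl

theorem exists_mem_of_tp {k : ℕ} {w w' : List α} (h : tp (k + 1) w = tp (k + 1) w')
    (hw : ∃ a ∈ w, ¬ P a) : ∃ a ∈ w', ¬ P a := by
  by_contra! hw'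
  obtain ⟨a, ha, hPa⟩ := hw
  exact hPa (forall_mem_of_tp h.symm hw' a ha)

/-- Spoiler plays the last letter of the leading part. The remaining two rounds force the answer to
be the corresponding cut: the rest must not start outside `P`, and no letter of `P` may follow one
outside `P` earlier on. -/
theorem Dec.tp_lead {w w' z₀ z₁ z₀' z₁' : List α} {Z Z' : List (List α)} (h : Dec P w z₀ Z z₁)
    (h' : Dec P w' z₀' Z' z₁') {j : ℕ} (hj : 2 ≤ j) (htp : tp (j + 1) w = tp (j + 1) w') :
    tp j z₀ = tp j z₀' := by
  obtain ⟨i, rfl⟩ := Nat.exists_eq_add_of_le' hj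
  obtain ⟨t, n, rfl, hn⟩ := h.lead.endN
  have hw := h.eq
  rw [List.append_assoc, List.singleton_append] at hw
  rw [hw] at htp
  obtain ⟨t', r', e', e1, e2⟩ := tp_succ_split htp
  have hr' : HeadP P r' := h.headP.of_tp e2
  have hcut : ∀ s m r, t' = s ++ m :: r → ¬ P m → ∀ a ∈ r, ¬ P a := by
    rintro s m r rfl hm a ha hPa
    obtain ⟨s', r'', rfl, -, e⟩ := tp_succ_split e1.symm
    have hl := h.lead
    rw [List.append_assoc] at hl
    have := hl.not_of_mem hm
    exact forall_mem_of_tp (p := fun a => ¬ P a) e.symm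
      (fun b hb => this b (by simp [hb])) a ha hPa
  suffices z₀' = t' ++ [n] by
    rw [this]
    exact tp_append e1 rfl
  have e3 : z₀' ++ (Z'.flatten ++ z₁') = (t' ++ [n]) ++ r' := by
    rw [← h'.eq, e', List.append_assoc, List.singleton_append]
  rcases List.append_eq_append_iff.1 e3 with ⟨s, e4, e5⟩ | ⟨s, e4, e5⟩
  · rcases s with _ | ⟨a, s⟩
    · simpa using e4.symm
    · exfalso
      have hPa : P a := h'.headP a _ e5
      obtain ⟨t'', m, hz, hm⟩ := h'.lead.endN
      rcases List.eq_nil_or_concat s with rfl | ⟨s, b, rfl⟩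
      · obtain ⟨-, e6⟩ := List.append_inj' e4 rfl
        obtain rfl : n = a := by simpa using e6
        exact hn hPa
      · have e6 : t' ++ [n] = (z₀' ++ a :: s) ++ [b] := by rw [e4]; simp
        obtain ⟨e6, -⟩ := List.append_inj' e6 rfl
        rw [hz, List.append_assoc] at e6
        exact hcut _ _ _ e6 hm a (by simp) hPa
  · rcases s with _ | ⟨a, s⟩
    · simpa using e4
    · exfalso
      have hPa : P a := hr' a _ e5
      have hl := h'.lead
      rw [e4] at hl
      exact hl.not_endN ⟨t', n, rfl, hn⟩ hPa

/-- The last part starts just after the last letter outside `P`, and one round locates that letter.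
-/
theorem Dec.tp_last {w w' z₀ z₁ z₀' z₁' : List α} {Z Z' : List (List α)} (h : Dec P w z₀ Z z₁)
    (h' : Dec P w' z₀' Z' z₁') {j : ℕ} (hj : 1 ≤ j) (htp : tp (j + 1) w = tp (j + 1) w') :
    tp j z₁ = tp j z₁' := by
  obtain ⟨i, rfl⟩ := Nat.exists_eq_add_of_le' hj
  obtain ⟨t, n, e, hn⟩ := h.lead.endN.append_flatten h.block
  obtain ⟨t', n', e', hn'⟩ := h'.lead.endN.append_flatten h'.block
  have hw := h.eq
  have hw' := h'.eq
  rw [← List.append_assoc, e, List.append_assoc, List.singleton_append] at hw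
  rw [← List.append_assoc, e', List.append_assoc, List.singleton_append] at hw'
  rw [hw] at htp
  obtain ⟨s, r, e1, -, e2⟩ := tp_succ_split htp
  have hr := forall_mem_of_tp e2 h.last
  obtain ⟨-, -, rfl⟩ := eq_of_append_cons_eq (hw'.symm.trans e1) hn' hn h'.last hr
  exact e2

/-- A move on a block is simulated by a move on its first letter. Both sides of that letter
decompose again: the left with an empty last part, the right with the rest of the block as leading
part. So the induction continues, and `Dec.tp_lead` recovers the type of the chosen block. -/
theorem Dec.tp_map {β : Type v} {j : ℕ} (hj : 2 ≤ j) {δ : List α → β}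
    (hδ : ∀ y y', tp j y = tp j y' → δ y = δ y') {k : ℕ} {w w' z₀ z₁ z₀' z₁' : List α}
    {Z Z' : List (List α)} (h : Dec P w z₀ Z z₁) (h' : Dec P w' z₀' Z' z₁')
    (htp : tp (k + j + 1) w = tp (k + j + 1) w') : tp k (Z.map δ) = tp k (Z'.map δ) := by
  induction k generalizing w w' z₀ z₁ z₀' z₁' Z Z' with
  | zero => rfl
  | succ k ih =>
    have key : ∀ {w w' z₀ z₁ z₀' z₁' : List α} {Z Z' : List (List α)}, Dec P w z₀ Z z₁ →
        Dec P w' z₀' Z' z₁' → tp (k + 1 + j + 1) w = tp (k + 1 + j + 1) w' → ∀ u d v,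
        Z.map δ = u ++ d :: v →
          ∃ u' v', Z'.map δ = u' ++ d :: v' ∧ tp k u = tp k u' ∧ tp k v = tp k v' := by
      intro w w' z₀ z₁ z₀' z₁' Z Z' h h' htp u d v hZ
      obtain ⟨X, T, rfl, rfl, hT⟩ := List.map_eq_append_iff.1 hZ
      obtain ⟨y, Y, rfl, rfl, rfl⟩ := List.map_eq_cons_iff.1 hT
      obtain ⟨a, y, rfl, ha, hy⟩ := (h.block y (by simp)).exists_cons
      have hU : Dec P (z₀ ++ X.flatten) z₀ X [] :=
        ⟨by simp, h.lead, fun z hz => h.block z (by simp [hz]), by simp⟩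
      have hV : Dec P (y ++ (Y.flatten ++ z₁)) y Y z₁ :=
        ⟨rfl, hy, fun z hz => h.block z (by simp [hz]), h.last⟩
      have hw : w = (z₀ ++ X.flatten) ++ a :: (y ++ (Y.flatten ++ z₁)) := by rw [h.eq]; simp
      rw [hw] at htp
      obtain ⟨U', V', e', e1, e2⟩ := tp_succ_split htp
      have hU' : EndN P U' := (hU.lead.endN.append_flatten hU.block).of_tp (k := 0)
        (tp_mono (by omega) e1)
      have hV' : ∃ b ∈ V', ¬ P b := by
        refine exists_mem_of_tp (k := 0) (tp_mono (by omega) e2) ?_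
        obtain ⟨b, hb, hb'⟩ := hy.endN.exists_mem
        exact ⟨b, by simp [hb], hb'⟩
      obtain ⟨X', y', Y', rfl, rfl, rfl⟩ := exists_block_of_cut h'.lead h'.block h'.last
        (h'.eq.symm.trans e') hU' ha hV'
      have hdU : Dec P (z₀' ++ X'.flatten) z₀' X' [] :=
        ⟨by simp, h'.lead, fun z hz => h'.block z (by simp [hz]), by simp⟩
      obtain ⟨_, _, e, -, hy'⟩ := (h'.block (a :: y') (by simp)).exists_cons
      obtain ⟨rfl, rfl⟩ := List.cons.inj e
      have hdV : Dec P (y' ++ (Y'.flatten ++ z₁')) y' Y' z₁' :=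
        ⟨rfl, hy', fun z hz => h'.block z (by simp [hz]), h'.last⟩
      have e3 : k + 1 + j = k + j + 1 := by omega
      rw [e3] at e1 e2
      have hyy : tp j y = tp j y' := hV.tp_lead hdV hj (tp_mono (by omega) e2)
      refine ⟨X'.map δ, Y'.map δ, ?_, ih hU hdU e1, ih hV hdV e2⟩
      rw [List.map_append, List.map_cons, hδ (a :: y) (a :: y')]
      exact tp_append (u := [a]) rfl hyy
    exact tp_succ_eq (key h h' htp) (key h' h htp.symm)

/-- Spoiler plays the last letter of `x`; one further round makes sure that no letter of `P` follows
the answer. -/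
theorem tp_split_of_append {j : ℕ} (hj : 1 ≤ j) {x y x' y' : List α} (hx : ∀ a ∈ x, P a)
    (hy : ∀ a ∈ y, ¬ P a) (hx' : ∀ a ∈ x', P a) (hy' : ∀ a ∈ y', ¬ P a) (hne : x ≠ [])
    (htp : tp (j + 1) (x ++ y) = tp (j + 1) (x' ++ y')) :
    x' ≠ [] ∧ tp j x = tp j x' ∧ tp j y = tp j y' := by
  obtain ⟨i, rfl⟩ := Nat.exists_eq_add_of_le' hj
  obtain ⟨t, a, rfl⟩ := exists_eq_append_singleton hne
  have ha : P a := hx a (by simp)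
  rw [List.append_assoc, List.singleton_append] at htp
  obtain ⟨t', v, e, e1, e2⟩ := tp_succ_split htp
  have hv := forall_mem_of_tp e2 hy
  have hne' : x' ≠ [] := by
    rintro rfl
    rw [List.nil_append] at e
    exact hy' a (by simp [e]) ha
  obtain ⟨t'', b, rfl⟩ := exists_eq_append_singleton hne'
  rw [List.append_assoc, List.singleton_append] at e
  obtain ⟨rfl, rfl, rfl⟩ := eq_of_append_cons_eq (q := fun a => ¬ P a) e
    (not_not.2 (hx' b (by simp))) (not_not.2 ha) hy' hv
  refine ⟨by simp, ?_, e2⟩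
  exact tp_append e1 rfl

end Decomposition

theorem tp_eq_of_append {α : Type u} {P : α → Prop} {j : ℕ} (hj : 1 ≤ j) {x y x' y' : List α}
    (hx : ∀ a ∈ x, P a) (hy : ∀ a ∈ y, ¬ P a) (hx' : ∀ a ∈ x', P a) (hy' : ∀ a ∈ y', ¬ P a)
    (htp : tp (j + 1) (x ++ y) = tp (j + 1) (x' ++ y')) :
    tp j x = tp j x' ∧ tp j y = tp j y' := by
  rcases eq_or_ne x [] with rfl | hne
  · rcases eq_or_ne x' [] with rfl | hne'
    · exact ⟨rfl, tp_of_succ htp⟩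
    · exact absurd rfl (tp_split_of_append hj hx' hy' hx hy hne' htp.symm).1
  · exact (tp_split_of_append hj hx hy hx' hy' hne htp).2

/-! ### Common bounds and the block induction step -/

section Bounded

variable {S : Type v} [Semigroup S]

/-- The values of the words of `L` have a common upper bound in the saturation, and `L` does not
mix the empty word with nonempty words. -/
def Bnd (𝒯 : Subsemigroup (Set S)) (L : Set (List (Set S))) : Prop :=
  (∀ w ∈ L, w = []) ∨ ∃ U, MemSat 𝒯 U ∧ ∀ w ∈ L, w ≠ [] ∧ ev w ⊆ U

theorem Bnd.subset {𝒯 : Subsemigroup (Set S)} {L L' : Set (List (Set S))} (h : Bnd 𝒯 L)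
    (hL : L' ⊆ L) : Bnd 𝒯 L' := by
  rcases h with h | ⟨U, hU, h⟩
  · exact .inl fun w hw => h w (hL hw)
  · exact .inr ⟨U, hU, fun w hw => h w (hL hw)⟩

theorem Bnd.of_closure {A : Set (Set S)} {𝒯 : Subsemigroup (Set S)} {L : Set (List (Set S))}
    (h : Bnd (Subsemigroup.closure A) L) (hA : ∀ T ∈ A, MemSat 𝒯 T) : Bnd 𝒯 L := by
  rcases h with h | ⟨U, hU, h⟩
  · exact .inl h
  · exact .inr ⟨U, hU.of_closure hA, h⟩

theorem Bnd.append {𝒯 : Subsemigroup (Set S)} {L L' : Set (List (Set S))} (h : Bnd 𝒯 L)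
    (h' : Bnd 𝒯 L') : Bnd 𝒯 (Set.image2 (· ++ ·) L L') := by
  rcases h with h | ⟨U, hU, h⟩
  · refine h'.subset ?_
    rintro _ ⟨u, hu, v, hv, rfl⟩
    simpa [h u hu] using hv
  · rcases h' with h' | ⟨U', hU', h'⟩
    · refine .inr ⟨U, hU, ?_⟩
      rintro _ ⟨u, hu, v, hv, rfl⟩
      simpa [h' v hv] using h u hu
    · refine .inr ⟨U * U', hU.mul hU', ?_⟩
      rintro _ ⟨u, hu, v, hv, rfl⟩
      obtain ⟨hu1, hu2⟩ := h u hu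
      obtain ⟨hv1, hv2⟩ := h' v hv
      refine ⟨by simp [hu1], ?_⟩
      simp only
      rw [ev_append hu1 hv1]
      exact Set.mul_subset_mul hu2 hv2

theorem Bnd.exists_bound {𝒯 : Subsemigroup (Set S)} {L : Set (List (Set S))} (h : Bnd 𝒯 L)
    {w : List (Set S)} (hw : w ∈ L) (hne : w ≠ []) : ∃ U, MemSat 𝒯 U ∧ ∀ w ∈ L, ev w ⊆ U := by
  rcases h with h | ⟨U, hU, h⟩
  · exact absurd (h w hw) hne
  · exact ⟨U, hU, fun w hw => (h w hw).2⟩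

/-- The induction step for a decomposition of words over `A` into blocks: the blocks are the letters
of words over a new alphabet, whose products are subsets of a smaller set `Q`. -/
theorem Bnd.of_blocks [Finite S] {A : Set (Set S)} {𝒯 : Subsemigroup (Set S)} (P : Set S → Prop)
    {Q : Set S} {n j : ℕ} (hj : 1 ≤ j)
    (hP : ∀ w, (∀ a ∈ w, a ∈ A ∧ P a) →
      Bnd 𝒯 {v | (∀ a ∈ v, a ∈ A ∧ P a) ∧ tp j v = tp j w})
    (hN : ∀ w, (∀ a ∈ w, a ∈ A ∧ ¬ P a) →
      Bnd 𝒯 {v | (∀ a ∈ v, a ∈ A ∧ ¬ P a) ∧ tp j v = tp j w})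
    (hQ : ∀ y, (∀ a ∈ y, a ∈ A) → Block P y → ev y ⊆ Q) (hQQ : Q * Q ⊆ Q) (hn : Q.ncard ≤ n)
    (ih : ∀ A' : Set (Set S), (⋃₀ (Subsemigroup.closure A' : Set (Set S))).ncard ≤ n →
      ∀ w : List (Set S), (∀ a ∈ w, a ∈ A') → Bnd (Subsemigroup.closure A')
        {v | (∀ a ∈ v, a ∈ A') ∧ tp (A'.ncard * 2 ^ n ^ 2) v = tp (A'.ncard * 2 ^ n ^ 2) w})
    {w : List (Set S)} (hw : ∀ a ∈ w, a ∈ A) :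
    Bnd 𝒯 {v | (∀ a ∈ v, a ∈ A) ∧
      tp (2 ^ n * 2 ^ n ^ 2 + (j + 1) + 1) v = tp (2 ^ n * 2 ^ n ^ 2 + (j + 1) + 1) w} := by
  by_cases hwP : ∀ a ∈ w, P a
  · refine (hP w fun a ha => ⟨hw a ha, hwP a ha⟩).subset ?_
    rintro v ⟨hv, htp⟩
    have := forall_mem_of_tp htp.symm hwP
    exact ⟨fun a ha => ⟨hv a ha, this a ha⟩, tp_mono (by omega) htp⟩
  push Not at hwP
  have hlead : ∀ z, (∀ a ∈ z, a ∈ A) → Lead P z →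
      Bnd 𝒯 {z' | (∀ a ∈ z', a ∈ A) ∧ Lead P z' ∧ tp (j + 1) z' = tp (j + 1) z} := by
    rintro _ hA ⟨x, y, rfl, hx, hy, -⟩
    refine ((hP x fun a ha => ⟨hA a (by simp [ha]), hx a ha⟩).append
      (hN y fun a ha => ⟨hA a (by simp [ha]), hy a ha⟩)).subset ?_
    rintro _ ⟨hA', ⟨x', y', rfl, hx', hy', -⟩, htp⟩
    obtain ⟨e1, e2⟩ := tp_eq_of_append hj hx' hy' hx hy htp
    exact ⟨x', ⟨fun a ha => ⟨hA' a (by simp [ha]), hx' a ha⟩, e1⟩,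
      y', ⟨fun a ha => ⟨hA' a (by simp [ha]), hy' a ha⟩, e2⟩, rfl⟩
  -- The union over the whole type class depends only on the type and still lies in `Q`, so at most
  -- `2 ^ n` letters arise; a bound taken from the saturation need not lie in `Q`.
  let δ : List (Set S) → Set S := fun y =>
    ⋃₀ (ev '' {y' | (∀ a ∈ y', a ∈ A) ∧ Block P y' ∧ tp (j + 1) y' = tp (j + 1) y})
  have hδ : ∀ y y', tp (j + 1) y = tp (j + 1) y' → δ y = δ y' := by
    intro y y' h
    simp only [δ, h]
  have hevδ : ∀ y, (∀ a ∈ y, a ∈ A) → Block P y → ev y ⊆ δ y := fun y hA hy =>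
    Set.subset_sUnion_of_mem ⟨y, ⟨hA, hy, rfl⟩, rfl⟩
  let A' : Set (Set S) := δ '' {y | (∀ a ∈ y, a ∈ A) ∧ Block P y}
  have hA'sat : ∀ T ∈ A', MemSat 𝒯 T := by
    rintro _ ⟨y, ⟨hA, hy⟩, rfl⟩
    obtain ⟨U, hU, h⟩ := (hlead y hA hy.lead).exists_bound ⟨hA, hy.lead, rfl⟩ hy.ne_nil
    refine hU.downset (Set.sUnion_subset ?_)
    rintro _ ⟨y', ⟨hA', hy', htp⟩, rfl⟩
    exact h y' ⟨hA', hy'.lead, htp⟩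
  have hA'Q : A' ⊆ 𝒫 Q := by
    rintro _ ⟨y, ⟨hA, hy⟩, rfl⟩
    refine Set.sUnion_subset ?_
    rintro _ ⟨y', ⟨hA', hy', -⟩, rfl⟩
    exact hQ y' hA' hy'
  have hclQ : ⋃₀ (Subsemigroup.closure A' : Set (Set S)) ⊆ Q := by
    refine Set.sUnion_subset fun T hT => ?_
    induction hT using Subsemigroup.closure_induction with
    | mem T hT => exact hA'Q hT
    | mul T T' _ _ ih ih' => exact (Set.mul_subset_mul ih ih').trans hQQ
  have hcard : A'.ncard ≤ 2 ^ n := by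
    refine (Set.ncard_le_ncard hA'Q (Set.toFinite _)).trans ?_
    rw [Set.ncard_powerset Q]
    exact Nat.pow_le_pow_right (by norm_num) hn
  obtain ⟨z₀, Z, z₁, hd⟩ := exists_dec hwP
  have hwA : (∀ a ∈ z₀, a ∈ A) ∧ (∀ z ∈ Z, ∀ a ∈ z, a ∈ A) ∧ ∀ a ∈ z₁, a ∈ A := by
    rw [hd.eq] at hw
    exact ⟨fun a ha => hw a (by simp [ha]), fun z hz a ha => hw a (by
      simp only [List.mem_append, List.mem_flatten]; exact .inr (.inl ⟨z, hz, ha⟩)),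
      fun a ha => hw a (by simp [ha])⟩
  have hmid : Bnd 𝒯 {l | ∃ Z' : List (List (Set S)), l = Z'.flatten ∧ (∀ z ∈ Z', Block P z) ∧
      (∀ z ∈ Z', ∀ a ∈ z, a ∈ A) ∧
      tp (2 ^ n * 2 ^ n ^ 2) (Z'.map δ) = tp (2 ^ n * 2 ^ n ^ 2) (Z.map δ)} := by
    obtain ⟨r, hr⟩ : ∃ r, 2 ^ n * 2 ^ n ^ 2 = r + 1 :=
      ⟨2 ^ n * 2 ^ n ^ 2 - 1, (Nat.sub_add_cancel (Nat.one_le_iff_ne_zero.2 (by positivity))).symm⟩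
    rcases eq_or_ne Z [] with rfl | hZ
    · left
      rintro _ ⟨Z', rfl, -, -, htp⟩
      rw [hr] at htp
      have := eq_nil_of_tp htp.symm
      rw [List.map_eq_nil_iff] at this
      rw [this, List.flatten_nil]
    · have hmem : ∀ {Z' : List (List (Set S))}, (∀ z ∈ Z', Block P z) →
          (∀ z ∈ Z', ∀ a ∈ z, a ∈ A) → ∀ a ∈ Z'.map δ, a ∈ A' := by
        intro Z' h1 h2 a ha
        obtain ⟨z, hz, rfl⟩ := List.mem_map.1 ha
        exact ⟨z, ⟨h2 z hz, h1 z hz⟩, rfl⟩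
      have hwZ := hmem hd.block hwA.2.1
      obtain ⟨U, hU, h⟩ := (ih A' ((Set.ncard_le_ncard hclQ (Set.toFinite _)).trans hn) _
        hwZ).exists_bound ⟨hwZ, rfl⟩ (by simpa using hZ)
      refine .inr ⟨U, hU.of_closure hA'sat, ?_⟩
      rintro _ ⟨Z', rfl, h1, h2, htp⟩
      have hZ' : Z' ≠ [] := by
        rintro rfl
        rw [hr] at htp
        exact hZ (by simpa using eq_nil_of_tp htp)
      have hne : ∀ z ∈ Z', z ≠ [] := fun z hz => (h1 z hz).ne_nil
      constructor
      · obtain ⟨y, hy⟩ := List.exists_mem_of_ne_nil Z' hZ'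
        intro h0
        exact hne y hy (List.flatten_eq_nil_iff.1 h0 y hy)
      · rw [ev_flatten hne hZ']
        exact (ev_map_mono fun z hz => hevδ z (h2 z hz) (h1 z hz)).trans
          (h _ ⟨hmem h1 h2, tp_mono (Nat.mul_le_mul_right _ hcard) htp⟩)
  -- The rank splits as `2 ^ n * 2 ^ n ^ 2` rounds on the block word, `j + 1` for the types naming
  -- the blocks and one to locate a cut.
  refine ((hlead z₀ hwA.1 hd.lead).append (hmid.append
    (hP z₁ fun a ha => ⟨hwA.2.2 a ha, hd.last a ha⟩))).subset ?_
  rintro v ⟨hv, htp⟩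
  obtain ⟨z₀', Z', z₁', hd'⟩ := exists_dec (exists_mem_of_tp htp.symm hwP)
  have hvA : (∀ a ∈ z₀', a ∈ A) ∧ (∀ z ∈ Z', ∀ a ∈ z, a ∈ A) ∧ ∀ a ∈ z₁', a ∈ A := by
    rw [hd'.eq] at hv
    exact ⟨fun a ha => hv a (by simp [ha]), fun z hz a ha => hv a (by
      simp only [List.mem_append, List.mem_flatten]; exact .inr (.inl ⟨z, hz, ha⟩)),
      fun a ha => hv a (by simp [ha])⟩
  exact ⟨z₀', ⟨hvA.1, hd'.lead, hd'.tp_lead hd (by omega) (tp_mono (by omega) htp)⟩,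
    Z'.flatten ++ z₁', ⟨Z'.flatten, ⟨Z', rfl, hd'.block, hvA.2.1,
      hd'.tp_map (by omega) hδ hd htp⟩, z₁', ⟨fun a ha => ⟨hvA.2.2 a ha, hd'.last a ha⟩,
      hd'.tp_last hd hj (tp_mono (by omega) htp)⟩, rfl⟩, hd'.eq.symm⟩

end Bounded

/-! ### The induction on the size of the union and of the alphabet -/

section Induction

variable {S : Type v} [Semigroup S]

theorem subset_sUnion_closure {A : Set (Set S)} {T : Set S} (hT : T ∈ Subsemigroup.closure A) :
    T ⊆ ⋃₀ (Subsemigroup.closure A : Set (Set S)) :=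
  Set.subset_sUnion_of_mem (SetLike.mem_coe.2 hT)

theorem ev_mem_closure {A : Set (Set S)} {w : List (Set S)} (hne : w ≠ [])
    (hw : ∀ a ∈ w, a ∈ A) : ev w ∈ Subsemigroup.closure A :=
  ev_mem (M := {T | T ∈ Subsemigroup.closure A}) 
    (fun _ h _ h' => (Subsemigroup.closure A).mul_mem h h') hne fun a ha => Subsemigroup.subset_closure (hw a ha)

theorem sUnion_closure_mul_subset (A : Set (Set S)) :
    ⋃₀ (Subsemigroup.closure A : Set (Set S)) * ⋃₀ (Subsemigroup.closure A : Set (Set S)) ⊆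
      ⋃₀ (Subsemigroup.closure A : Set (Set S)) := by
  rintro _ ⟨x, ⟨T, hT, hx⟩, y, ⟨T', hT', hy⟩, rfl⟩
  exact ⟨T * T', mul_mem (SetLike.mem_coe.1 hT) hT', Set.mul_mem_mul hx hy⟩

theorem Bnd.of_sUnion {A : Set (Set S)}
    (h : MemSat (Subsemigroup.closure A) (⋃₀ (Subsemigroup.closure A : Set (Set S)))) {k : ℕ}
    (hk : 1 ≤ k) (w : List (Set S)) :
    Bnd (Subsemigroup.closure A) {v | (∀ a ∈ v, a ∈ A) ∧ tp k v = tp k w} := by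
  obtain ⟨k, rfl⟩ := Nat.exists_eq_add_of_le' hk
  rcases eq_or_ne w [] with rfl | hw
  · exact .inl fun v hv => eq_nil_of_tp hv.2.symm
  · refine .inr ⟨_, h, fun v hv => ?_⟩
    have hne : v ≠ [] := by
      rintro rfl
      exact hw (eq_nil_of_tp hv.2)
    exact ⟨hne, subset_sUnion_closure (ev_mem_closure hne hv.1)⟩

theorem MemSat.sUnion_of_subsingleton {A : Set (Set S)} (hA : A.Nonempty)
    (h : (⋃₀ (Subsemigroup.closure A : Set (Set S))).Subsingleton) :
    MemSat (Subsemigroup.closure A) (⋃₀ (Subsemigroup.closure A : Set (Set S))) := by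
  obtain ⟨a, ha⟩ := hA
  rcases Set.eq_empty_or_nonempty (⋃₀ (Subsemigroup.closure A : Set (Set S))) with h0 | ⟨r, hr⟩
  · rw [h0]
    exact (MemSat.base (Subsemigroup.subset_closure ha)).downset (Set.empty_subset _)
  · obtain ⟨T, hT, hrT⟩ := hr
    refine (MemSat.base hT).downset fun s hs => ?_
    rwa [h hs ⟨T, hT, hrT⟩]

theorem Bnd.of_run [Finite S] {A : Set (Set S)} {b : Set S} (hb : b ∈ A) {j : ℕ}
    (hj : 2 ^ (⋃₀ (Subsemigroup.closure A : Set (Set S))).ncard ≤ j) {w : List (Set S)}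
    (hw : ∀ a ∈ w, a = b) :
    Bnd (Subsemigroup.closure A) {v | (∀ a ∈ v, a = b) ∧ tp j v = tp j w} := by
  by_cases hlt : w.length < j
  -- Below the threshold the type fixes the length, hence the run; above it all powers share one
  -- bound.
  · have hv : ∀ v ∈ {v : List (Set S) | (∀ a ∈ v, a = b) ∧ tp j v = tp j w}, v = w := by
      rintro v ⟨hv, htp⟩
      have := length_of_tp htp
      rw [List.eq_replicate_of_mem hw, List.eq_replicate_of_mem hv]
      congr 1
      omega
    rcases eq_or_ne w [] with rfl | hne
    · exact .inl hv
    · refine .inr ⟨ev w, .base (ev_mem_closure hne fun a ha => hw a ha ▸ hb), fun v hv' => ?_⟩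
      rw [hv v hv']
      exact ⟨hne, subset_rfl⟩
  · obtain ⟨U, hU, h⟩ := (MemSat.base (Subsemigroup.subset_closure hb)).exists_bound_spow
      (subset_sUnion_closure (Subsemigroup.subset_closure hb)) (sUnion_closure_mul_subset A)
    refine .inr ⟨U, hU, ?_⟩
    rintro v ⟨hv, htp⟩
    have hlen : j ≤ v.length := by
      have := length_of_tp htp
      omega
    have hpos : 0 < v.length := by
      have := Nat.one_le_two_pow (n := (⋃₀ (Subsemigroup.closure A : Set (Set S))).ncard)
      omega
    refine ⟨List.ne_nil_of_length_pos hpos, ?_⟩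
    rw [List.eq_replicate_of_mem hv]
    exact (ev_replicate b ⟨v.length, hpos⟩).le.trans (h ⟨v.length, hpos⟩ (hj.trans hlen))

/-- With `x = 2 ^ (n ^ 2 + 2 * n - 1)`, the new summand on the right is `4 * x`, while `2 ^ n * 2 ^
n ^ 2`, `2 ^ (n + 1)` and `2` are each at most `x`. It fails for `n = 0`. -/
theorem rank_arith {n : ℕ} (hn : 1 ≤ n) (m : ℕ) :
    2 ^ n * 2 ^ n ^ 2 + (m * 2 ^ (n + 1) ^ 2 + 2 ^ (n + 1) + 1) + 1 ≤
      (m + 1) * 2 ^ (n + 1) ^ 2 := by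
  have h1 : 2 ^ n * 2 ^ n ^ 2 ≤ 2 ^ (n ^ 2 + 2 * n - 1) := by
    rw [← pow_add]
    exact Nat.pow_le_pow_right (by norm_num) (by omega)
  have h2 : 2 ^ (n + 1) ≤ 2 ^ (n ^ 2 + 2 * n - 1) :=
    Nat.pow_le_pow_right (by norm_num) (Nat.le_sub_one_of_lt (by nlinarith))
  have h3 : 2 ^ (n + 1) ^ 2 = 4 * 2 ^ (n ^ 2 + 2 * n - 1) := by
    rw [show (n + 1) ^ 2 = (n ^ 2 + 2 * n - 1) + 2 by
      have : 1 ≤ n ^ 2 + 2 * n := by nlinarith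
      have : (n + 1) ^ 2 = n ^ 2 + 2 * n + 1 := by ring
      omega, pow_add]
    ring
  have h4 : 2 ≤ 2 ^ (n ^ 2 + 2 * n - 1) :=
    le_trans (by
      have : 2 ^ 1 ≤ 2 ^ (n + 1) := Nat.pow_le_pow_right (by norm_num) (by omega)
      simpa using this) h2
  rw [add_mul, one_mul]
  omega

/-- The words over `A` with a given type of sufficiently large rank have values with a common upper
bound in the saturation. -/
theorem bnd_tp [Finite S] (n m : ℕ) (A : Set (Set S)) (hm : A.ncard ≤ m)
    (hn : (⋃₀ (Subsemigroup.closure A : Set (Set S))).ncard ≤ n) (w : List (Set S))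
    (hw : ∀ a ∈ w, a ∈ A) :
    Bnd (Subsemigroup.closure A)
      {v | (∀ a ∈ v, a ∈ A) ∧ tp (m * 2 ^ n ^ 2) v = tp (m * 2 ^ n ^ 2) w} := by
  induction n generalizing m A w with
  | zero =>
    rcases A.eq_empty_or_nonempty with rfl | hA
    · exact .inl fun v hv => List.eq_nil_iff_forall_not_mem.2 hv.1
    · have hpos := (Set.ncard_pos (Set.toFinite A)).2 hA
      refine Bnd.of_sUnion (MemSat.sUnion_of_subsingleton hA ?_)
        (Nat.mul_pos (by omega) (by positivity)) w
      exact (Set.ncard_le_one_iff_subsingleton).1 (by omega)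
  | succ n ihn =>
    induction m generalizing A w with
    | zero =>
      have hA : A = ∅ := (Set.ncard_eq_zero (Set.toFinite A)).1 (by omega)
      subst hA
      exact .inl fun v hv => List.eq_nil_iff_forall_not_mem.2 hv.1
    | succ m ihm =>
      rcases A.eq_empty_or_nonempty with rfl | hA
      · exact .inl fun v hv => List.eq_nil_iff_forall_not_mem.2 hv.1
      have hk : 1 ≤ (m + 1) * 2 ^ (n + 1) ^ 2 := Nat.mul_pos (by omega) (by positivity)
      -- Unions of size at most one are set aside so that `rank_arith` applies with `1 ≤ n`.
      by_cases h1 : (⋃₀ (Subsemigroup.closure A : Set (Set S))).ncard ≤ 1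
      · exact Bnd.of_sUnion (MemSat.sUnion_of_subsingleton hA
          ((Set.ncard_le_one_iff_subsingleton).1 h1)) hk w
      set R := ⋃₀ (Subsemigroup.closure A : Set (Set S)) with hR
      by_cases htame : ∀ a ∈ A, a * R = R ∧ R * a = R
      · exact Bnd.of_sUnion (MemSat.sUnion_of_tame hA (fun a ha => (htame a ha).1)
          fun a ha => (htame a ha).2) hk w
      push Not at htame
      obtain ⟨b, hb, htame⟩ := htame
      have hRR : R * R ⊆ R := sUnion_closure_mul_subset A
      have hbR : b ⊆ R := subset_sUnion_closure (Subsemigroup.subset_closure hb)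
      -- In the rank, `m * 2 ^ (n + 1) ^ 2` pays for words without `b` and `2 ^ (n + 1)` for runs of
      -- `b`.
      have hC : ∀ w, (∀ a ∈ w, a ∈ A ∧ a ≠ b) → Bnd (Subsemigroup.closure A)
          {v | (∀ a ∈ v, a ∈ A ∧ a ≠ b) ∧
            tp (m * 2 ^ (n + 1) ^ 2 + 2 ^ (n + 1)) v =
              tp (m * 2 ^ (n + 1) ^ 2 + 2 ^ (n + 1)) w} := by
        intro w hw
        have hsub : A \ {b} ⊆ A := Set.sdiff_subset
        have := ihm (A \ {b}) (by rw [Set.ncard_sdiff_singleton_of_mem hb]; omega)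
          ((Set.ncard_le_ncard (Set.sUnion_subset_sUnion
            (SetLike.coe_subset_coe.2 (Subsemigroup.closure_mono hsub))) (Set.toFinite _)).trans hn)
          w (fun a ha => ⟨(hw a ha).1, (hw a ha).2⟩)
        refine (this.of_closure fun T hT => .base (Subsemigroup.subset_closure (hsub hT))).subset ?_
        rintro v ⟨hv, htp⟩
        exact ⟨fun a ha => ⟨(hv a ha).1, (hv a ha).2⟩, tp_mono (Nat.le_add_right _ _) htp⟩
      have hB : ∀ w, (∀ a ∈ w, a ∈ A ∧ a = b) → Bnd (Subsemigroup.closure A)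
          {v | (∀ a ∈ v, a ∈ A ∧ a = b) ∧
            tp (m * 2 ^ (n + 1) ^ 2 + 2 ^ (n + 1)) v =
              tp (m * 2 ^ (n + 1) ^ 2 + 2 ^ (n + 1)) w} := by
        intro w hw
        refine (Bnd.of_run hb ?_ fun a ha => (hw a ha).2).subset
          (fun v hv => ⟨fun a ha => (hv.1 a ha).2, hv.2⟩)
        exact (Nat.pow_le_pow_right (by norm_num) hn).trans (Nat.le_add_left _ _)
      have hjpos : 1 ≤ m * 2 ^ (n + 1) ^ 2 + 2 ^ (n + 1) :=
        Nat.one_le_two_pow.trans (Nat.le_add_left _ _)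
      have ihn' := fun A' h => ihn A'.ncard A' le_rfl h
      have hrank := rank_arith (n := n) (by omega) m
      -- The side on which `b` loses elements decides the shape of the blocks: they end with `b`
      -- when `R b ⊊ R` and start with `b` when `b R ⊊ R`.
      by_cases hbl : b * R = R
      · have hRb : R * b ⊆ R := (Set.mul_subset_mul_left hbR).trans hRR
        have hlt := Set.ncard_lt_ncard (hRb.ssubset_of_ne (htame hbl)) (Set.toFinite _)
        refine (Bnd.of_blocks (fun a => a ≠ b) (Q := R * b) (n := n) hjpos hC
          (by simpa only [not_not] using hB) ?_ ?_ (by omega) ihn' hw).subset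
            fun v hv => ⟨hv.1, tp_mono hrank hv.2⟩
        · rintro _ hA' ⟨x, y, rfl, hx, hy, hx0, hy0⟩
          obtain ⟨t, c, rfl⟩ := exists_eq_append_singleton hy0
          obtain rfl : c = b := not_not.1 (hy c (by simp))
          have hne : x ++ t ≠ [] := by simp [hx0]
          rw [← List.append_assoc, ev_append hne (by simp)]
          exact Set.mul_subset_mul_right (subset_sUnion_closure (ev_mem_closure hne
            fun a ha => hA' a (by
              rw [← List.append_assoc]
              exact List.mem_append_left _ ha)))
        · rw [← mul_assoc]
          exact Set.mul_subset_mul_right ((Set.mul_subset_mul_right hRb).trans hRR)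
      · have hRb : b * R ⊆ R := (Set.mul_subset_mul_right hbR).trans hRR
        have hlt := Set.ncard_lt_ncard (hRb.ssubset_of_ne hbl) (Set.toFinite _)
        refine (Bnd.of_blocks (fun a => a = b) (Q := b * R) (n := n) hjpos hB hC ?_ ?_ (by omega)
          ihn' hw).subset fun v hv => ⟨hv.1, tp_mono hrank hv.2⟩
        · rintro _ hA' ⟨x, y, rfl, hx, hy, hx0, hy0⟩
          obtain ⟨c, t, rfl⟩ := List.exists_cons_of_ne_nil hx0
          obtain rfl : c = b := hx c (by simp)
          have hne : t ++ y ≠ [] := by simp [hy0]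
          rw [List.cons_append, ev_cons hne]
          exact Set.mul_subset_mul_left (subset_sUnion_closure (ev_mem_closure hne
            fun a ha => hA' a (by rw [List.cons_append]; exact List.mem_cons_of_mem _ ha)))
        · rw [mul_assoc]
          exact Set.mul_subset_mul_left ((Set.mul_subset_mul_left hRb).trans hRR)

end Induction

/-! ### From the morphism to words over subsets -/

section Main

variable {S : Type v} [Semigroup S] {B : Type u}

theorem letters_of_mul (x : B) (y : FreeSemigroup B) :
    letters (FreeSemigroup.of x * y) = x :: letters y := rfl

theorem coe_eq_ev {𝒮 : Subsemigroup (Set S)} (β : FreeSemigroup B →ₙ* 𝒮) (w : FreeSemigroup B) :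
    (β w : Set S) = ev ((letters w).map fun b => (β (FreeSemigroup.of b) : Set S)) := by
  induction w using FreeSemigroup.recOnMul with
  | ih1 x => rfl
  | ih2 x y _ ih =>
    rw [letters_of_mul, List.map_cons, ev_cons (by simp [letters]), ← ih, map_mul]
    rfl

theorem closure_range_eq {𝒮 : Subsemigroup (Set S)} (β : FreeSemigroup B →ₙ* 𝒮)
    (hβ : Function.Surjective β) :
    Subsemigroup.closure (Set.range fun b => (β (FreeSemigroup.of b) : Set S)) = 𝒮 := by
  refine le_antisymm (Subsemigroup.closure_le.2 ?_) fun T hT => ?_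
  · rintro _ ⟨b, rfl⟩
    exact (β (FreeSemigroup.of b)).2
  · obtain ⟨w, hw⟩ := hβ ⟨T, hT⟩
    have : T = β w := by rw [hw]
    rw [this, coe_eq_ev]
    refine ev_mem_closure (by simp [letters]) fun a ha => ?_
    obtain ⟨b, -, rfl⟩ := List.mem_map.1 ha
    exact ⟨b, rfl⟩

end Main

end FOSeparation

theorem mainTheorem3 {S : Type*} [Semigroup S] [Finite S] {B : Type*} [Finite B]
    (𝒮 : Subsemigroup (Set S)) (β : FreeSemigroup B →ₙ* 𝒮) (hβ : Function.Surjective β) :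
    ∃ P : Set (Set (FreeSemigroup B)), FOSeparation.IsFOPartition P ∧
      ∀ K ∈ P,
        ⋃₀ ((fun w => (β w : Set S)) '' K) ∈ FOSeparation.Sat 𝒮 ∧
        ∃ φ : (FOSeparation.wordLang B).Sentence,
          FOSeparation.definedBy φ = K ∧
          FOSeparation.qrank φ ≤ Nat.card B * 2 ^ ((⋃₀ (𝒮 : Set (Set S))).ncard ^ 2) := by
  open FOSeparation in
  set k := Nat.card B * 2 ^ ((⋃₀ (𝒮 : Set (Set S))).ncard ^ 2) with hk
  let r : Setoid (FreeSemigroup B) := Setoid.ker fun w => tp k (letters w)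
  have hdef : ∀ K ∈ r.classes, ∃ φ : (wordLang B).Sentence, definedBy φ = K ∧ qrank φ ≤ k := by
    rintro _ ⟨w, rfl⟩
    exact exists_sentence_tp_eq k (tp k (letters w))
  refine ⟨r.classes, ⟨Setoid.finite_classes_ker _, Setoid.isPartition_classes r, fun K hK => ?_⟩,
    fun K hK => ⟨?_, hdef K hK⟩⟩
  · obtain ⟨φ, hφ, -⟩ := hdef K hK
    exact ⟨φ, hφ⟩
  · obtain ⟨w, rfl⟩ := hK
    set f : B → Set S := fun b => (β (FreeSemigroup.of b) : Set S)
    have hmem : ∀ v : FreeSemigroup B, ∀ a ∈ (letters v).map f, a ∈ Set.range f := by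
      intro v a ha
      obtain ⟨b, -, rfl⟩ := List.mem_map.1 ha
      exact ⟨b, rfl⟩
    have hcl : Subsemigroup.closure (Set.range f) = 𝒮 := closure_range_eq β hβ
    -- Letters of `B` may share an image, so `|B|` only bounds the number of letter values;
    -- relabelling by `f` preserves equality of types.
    have hb := bnd_tp (⋃₀ (𝒮 : Set (Set S))).ncard (Nat.card B) (Set.range f)
      (by rw [← Nat.card_coe_set_eq]; exact Finite.card_range_le f) (by rw [hcl])
      ((letters w).map f) (hmem w)
    obtain ⟨U, hU, h⟩ := hb.exists_bound ⟨hmem w, rfl⟩ (by simp [letters])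
    rw [hcl] at hU
    refine hU.downset (Set.sUnion_subset ?_)
    rintro _ ⟨v, hv, rfl⟩
    simp only
    rw [coe_eq_ev]
    exact h _ ⟨hmem v, tp_map f hv⟩
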